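/- Let $l\ge 1$ be an integer. Let $B_{X1},B_{X2},\dots$ and $B_{Y1},B_{Y2},\dots$ be two i.i.d. sequences, each variable being uniformly distributed on $\{l-1,l,l+1\}$, and let $c_X,c_Y$ be uniformly distributed on $\{0,1\}$, all these random variables being independent. Let $X^\infty$ be the infinite binary sequence obtained by concatenating blocks of lengths $B_{X1},B_{X2},\dots$, the letter being $c_X$ in the odd-numbered blocks and $1-c_X$ in the even-numbered blocks, and define $Y^\infty$ in the same way from $c_Y$ and $(B_{Yi})_i$. (If $l=1$, some of the concatenated blocks may be empty.) For $n\ge 1$ let $X=X_1\cdots X_n$ and $Y=Y_1\cdots Y_n$ consist of the first $n$ letters of $X^\infty$ and $Y^\infty$. The blocks of a finite word are its maximal runs of equal letters. An alignment of $X$ and $Y$ is a finite set of pairs $(i,j)\in\{1,\dots,n\}^2$ with $X_i=Y_j$ that is strictly increasing in both coordinates; it is optimal if it has the largest possible number of pairs, namely the length of a longest common subsequence of $X$ and $Y$. A block of $X$ (of $Y$) is left out by an alignment if none of its positions occurs in a pair of the alignment; it is left out at the end if it and all blocks to its right are left out. For $\delta>0$ let $J^n(\delta)$ be the event that, in every optimal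 alignment of $X$ and $Y$, the number of blocks of $X$ left out at the end is at most $\delta$ times the total number of blocks of $X$, and the number of blocks of $Y$ left out at the end is at most $\delta$ times the total number of blocks of $Y$. **Proposition.** For every $\delta>0$ there is a constant $\theta>0$, depending only on $l$ and $\delta$ and not on $n$, such that for all sufficiently large $n$ \[ \mathrm{P}\bigl(J^n(\delta)^c\bigr)\le 2e^{-\theta n}. \] -/

import Mathlib

open MeasureTheory ProbabilityTheory

namespace BlockLCS

/-! ### Alignments and blocks of finite binary words -/

/-- An alignment of `x` and `y`, given by the set of pairs `(i, j)` such that the letter `x i` is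
aligned with the letter `y j`: aligned letters agree and the pairs are strictly increasing in both
coordinates. All other letters are aligned with gaps. The number of pairs is the length of the
common subsequence that the alignment defines. -/
def IsAlignment {m n : ℕ} (x : Fin m → Bool) (y : Fin n → Bool)
    (a : Finset (Fin m × Fin n)) : Prop :=
  (∀ p ∈ a, x p.1 = y p.2) ∧
    ∀ p ∈ a, ∀ q ∈ a, p ≠ q → (p.1 < q.1 ∧ p.2 < q.2) ∨ (q.1 < p.1 ∧ q.2 < p.2)

/-- An optimal alignment: its common subsequence is a longest common subsequence. -/
def IsOptimalAlignment {m n : ℕ} (x : Fin m → Bool) (y : Fin n → Bool)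
    (a : Finset (Fin m × Fin n)) : Prop :=
  IsAlignment x y a ∧ ∀ b : Finset (Fin m × Fin n), IsAlignment x y b → b.card ≤ a.card

/-- The block (maximal run of equal letters) of `x` containing position `k`, as a set of
positions. -/
def blockAt {n : ℕ} (x : Fin n → Bool) (k : Fin n) : Finset (Fin n) :=
  Finset.univ.filter fun j => ∀ i ∈ Finset.uIcc j k, x i = x k

/-- The set of all blocks of `x`. -/
def blocks {n : ℕ} (x : Fin n → Bool) : Finset (Finset (Fin n)) :=
  Finset.univ.image (blockAt x)

/-- The blocks of `x` that are left out at the end when `M` is the set of those positions of `x`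
that are not aligned with a gap: no letter of the block and no letter to the right of the block
is in `M`. -/
def leftOutAtEnd {n : ℕ} (x : Fin n → Bool) (M : Finset (Fin n)) : Finset (Finset (Fin n)) :=
  (blocks x).filter fun b => ∀ k ∈ b, ∀ j, k ≤ j → j ∉ M

/-- The proportion of blocks left out at the end, among all blocks of `x`. -/
noncomputable def propLeftOutAtEnd {n : ℕ} (x : Fin n → Bool) (M : Finset (Fin n)) : ℝ :=
  ((leftOutAtEnd x M).card : ℝ) / ((blocks x).card : ℝ)

/-- In every optimal alignment of `x` and `y`, the proportion of blocks left out at the end of `x`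
and the proportion of blocks left out at the end of `y` are both at most `δ`. -/
def FewLeftOutAtEnd (δ : ℝ) {m n : ℕ} (x : Fin m → Bool) (y : Fin n → Bool) : Prop :=
  ∀ a : Finset (Fin m × Fin n), IsOptimalAlignment x y a →
    propLeftOutAtEnd x (a.image Prod.fst) ≤ δ ∧ propLeftOutAtEnd y (a.image Prod.snd) ≤ δ

/-! ### The random binary sequences -/

/-- The index (from `0`) of the block containing position `k` (from `0`) in the infinite sequence
whose blocks have lengths `B 0, B 1, …`. -/
noncomputable def blockIndex (B : ℕ → ℕ) (k : ℕ) : ℕ :=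
  sInf {i | k < ∑ j ∈ Finset.range (i + 1), B j}

/-- The infinite binary sequence that is the concatenation of blocks of lengths `B 0, B 1, …`, the
letter of block `i` being `c` for even `i` and `!c` for odd `i`. -/
noncomputable def blockSeq (c : Bool) (B : ℕ → ℕ) (k : ℕ) : Bool :=
  xor c (decide (Odd (blockIndex B k)))

/-- The first `n` letters of that sequence. -/
noncomputable def blockWord (c : Bool) (B : ℕ → ℕ) (n : ℕ) : Fin n → Bool :=
  fun k => blockSeq c B k

/-- The data of one random sequence: the block lengths are i.i.d., uniform on `{l - 1, l, l + 1}`,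
and independent of the first letter, which is a fair bit. -/
structure IsBlockModel {Ω : Type*} [MeasurableSpace Ω] (P : Measure Ω) (l : ℕ)
    (c : Ω → Bool) (B : ℕ → Ω → ℕ) : Prop where
  measurable_c : Measurable c
  measurable_B : ∀ i, Measurable (B i)
  law_c : ∀ b : Bool, P {ω | c ω = b} = 1 / 2
  law_B : ∀ i, ∀ m ∈ ({l - 1, l, l + 1} : Set ℕ), P {ω | B i ω = m} = 1 / 3
  indep_B : iIndepFun B P
  indep_c : IndepFun c (fun ω i => B i ω) P

end BlockLCS

namespace BlockLCS

/-! If an optimal alignment leaves out a positive proportion of the blocks of `X` at the end, then a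
proper prefix of `X`, shorter by a fixed proportion, already has the same longest common subsequence
with `Y` as all of `X`. In the mean such a prefix loses a linear amount, and deviations from the
mean of linear order are exponentially unlikely.

To work with independent variables, fix the number of blocks instead of the number of letters. With
`n ≈ 2(a+1)kl`, the full words have about `2(a+1)k` blocks each, and the prefix has at most about
`2ak`. Let `g` and `g'` be the limits of the mean LCS divided by `k` for `2ak` against `2(a+1)k`
blocks and for `2(a+1)k` against `2(a+1)k` blocks; they exist by superadditivity
(`exists_tendsto_meanLcs_div`).

The point is `g < g'` (`eventually_meanLcs_add_le`), and neither value has to be known. Concatenate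
`q` pairs of the unbalanced kind with one pair in which the first word has `12(l+1)` times as many
blocks as the second; `q` is chosen so that the total is balanced. In the extra pair the first word
contains the second one entirely, up to exponentially small probability, since it has a long
alternating subsequence (`le_meanLcs`). That pair contributes about `2(a+1)l`, whereas `g ≤ 2al`
because an LCS is no longer than the first word. Hence `(q+1)g' ≥ (q+1)g + l`.

Concentration is the bounded differences inequality (`meanOver₂_exp_le`), since changing one block
length changes the LCS by at most `l+1`. It is proved for finite averages over lists and carried
over to `P` by `measureReal_blockLengths_le`. The same inequality controls the total lengths and
gives linearly many blocks (`le_card_blocks`). On the event where all these quantities are near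
their means, `not_manyLeftOutAtEnd` derives the contradiction. -/

/-! ### Longest common subsequences of lists -/

/-- The length of a longest common subsequence of two lists. -/
noncomputable def lcs (u v : List Bool) : ℕ :=
  sSup {k | ∃ w : List Bool, w.Sublist u ∧ w.Sublist v ∧ w.length = k}

lemma bddAbove_lcs (u v : List Bool) :
    BddAbove {k | ∃ w : List Bool, w.Sublist u ∧ w.Sublist v ∧ w.length = k} := by
  refine ⟨u.length, ?_⟩
  rintro k ⟨w, h, -, rfl⟩
  exact h.length_le

lemma length_le_lcs {u v w : List Bool} (hu : w.Sublist u) (hv : w.Sublist v) :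
    w.length ≤ lcs u v :=
  show w.length ≤ sSup _ from le_csSup (bddAbove_lcs u v) ⟨w, hu, hv, rfl⟩

lemma exists_length_eq_lcs (u v : List Bool) :
    ∃ w : List Bool, w.Sublist u ∧ w.Sublist v ∧ w.length = lcs u v :=
  Nat.sSup_mem (s := {k | ∃ w : List Bool, w.Sublist u ∧ w.Sublist v ∧ w.length = k})
    ⟨0, [], by simp, by simp, rfl⟩ (bddAbove_lcs u v)

lemma lcs_comm (u v : List Bool) : lcs u v = lcs v u := by
  unfold lcs
  congr 1
  ext k
  constructor <;> rintro ⟨w, h1, h2, h3⟩ <;> exact ⟨w, h2, h1, h3⟩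

lemma lcs_mono {u u' v v' : List Bool} (hu : u.Sublist u') (hv : v.Sublist v') :
    lcs u v ≤ lcs u' v' := by
  obtain ⟨w, h1, h2, h3⟩ := exists_length_eq_lcs u v
  rw [← h3]
  exact length_le_lcs (h1.trans hu) (h2.trans hv)

lemma lcs_le_left (u v : List Bool) : lcs u v ≤ u.length := by
  obtain ⟨w, h1, h2, h3⟩ := exists_length_eq_lcs u v
  rw [← h3]
  exact h1.length_le

lemma lcs_add_le_append (u u' v v' : List Bool) :
    lcs u v + lcs u' v' ≤ lcs (u ++ u') (v ++ v') := by
  obtain ⟨w, h1, h2, h3⟩ := exists_length_eq_lcs u v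
  obtain ⟨w', h1', h2', h3'⟩ := exists_length_eq_lcs u' v'
  rw [← h3, ← h3', ← List.length_append]
  exact length_le_lcs (h1.append h1') (h2.append h2')

/-- Deleting `b` destroys only those letters of a common subsequence that were matched inside `b`.
-/
lemma lcs_append_append_le (p b q v : List Bool) :
    lcs (p ++ (b ++ q)) v ≤ lcs (p ++ q) v + b.length := by
  obtain ⟨w, h1, h2, h3⟩ := exists_length_eq_lcs (p ++ (b ++ q)) v
  obtain ⟨w1, w', rfl, hw1, hw'⟩ := List.sublist_append_iff.1 h1
  obtain ⟨w2, w3, rfl, hw2, hw3⟩ := List.sublist_append_iff.1 hw'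
  have h4 : (w1 ++ w3).length ≤ lcs (p ++ q) v :=
    length_le_lcs (hw1.append hw3)
      (((List.Sublist.refl w1).append (List.sublist_append_right w2 w3)).trans h2)
  have h5 := hw2.length_le
  simp only [List.length_append] at h3 h4
  omega

lemma lcs_le_take_left (u v : List Bool) (i : ℕ) :
    lcs u v ≤ lcs (u.take i) v + (u.length - i) := by
  have h := lcs_append_append_le (u.take i) (u.drop i) [] v
  simpa using h

lemma lcs_le_take_right (u v : List Bool) (i : ℕ) :
    lcs u v ≤ lcs u (v.take i) + (v.length - i) := by
  rw [lcs_comm u, lcs_comm u]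
  exact lcs_le_take_left v u i

/-! ### Words with given block lengths -/

/-- The concatenation of blocks of the given lengths, with alternating letters starting with
`c`. -/
def wordOf : Bool → List ℕ → List Bool
  | _, [] => []
  | c, v :: s => List.replicate v c ++ wordOf (!c) s

lemma wordOf_append (c : Bool) (s t : List ℕ) :
    wordOf c (s ++ t) = wordOf c s ++ wordOf (xor c (decide (Odd s.length))) t := by
  induction s generalizing c with
  | nil => simp [wordOf]
  | cons v s ih =>
    simp only [List.cons_append, wordOf, ih, List.append_assoc, List.length_cons]
    congr 3
    by_cases h : Odd s.length
    · have : ¬ Odd (s.length + 1) := by rw [Nat.odd_add_one]; simpa using h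
      simp [h, this]
    · have : Odd (s.length + 1) := by rw [Nat.odd_add_one]; exact h
      simp [h, this]

lemma wordOf_append_of_even (c : Bool) {s : List ℕ} (hs : Even s.length) (t : List ℕ) :
    wordOf c (s ++ t) = wordOf c s ++ wordOf c t := by
  have : ¬ Odd s.length := Nat.not_odd_iff_even.2 hs
  simp [wordOf_append, this]

lemma length_wordOf (c : Bool) (s : List ℕ) : (wordOf c s).length = s.sum := by
  induction s generalizing c with
  | nil => rfl
  | cons v s ih => simp [wordOf, ih]

/-- Emptying the block costs at most `v` letters, and refilling it cannot hurt. The block keeps its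
place in the list even when empty, so the letters of all later blocks are unaffected. -/
lemma lcs_wordOf_le_of_replace (c : Bool) (p q : List ℕ) (v v' : ℕ) (u : List Bool) :
    lcs (wordOf c (p ++ v :: q)) u ≤ lcs (wordOf c (p ++ v' :: q)) u + v := by
  simp only [wordOf_append, wordOf]
  set d := xor c (decide (Odd p.length))
  have h := lcs_append_append_le (wordOf c p) (List.replicate v d) (wordOf (!d) q) u
  rw [List.length_replicate] at h
  refine h.trans (Nat.add_le_add_right (lcs_mono ?_ (List.Sublist.refl u)) v)
  exact (List.Sublist.refl _).append (List.sublist_append_right _ _)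

/-! ### Alternating subsequences -/

/-- The alternating word of length `k` that starts with `c`. -/
def altWord : Bool → ℕ → List Bool
  | _, 0 => []
  | c, k + 1 => c :: altWord (!c) k

lemma length_altWord (c : Bool) (k : ℕ) : (altWord c k).length = k := by
  induction k generalizing c with
  | zero => rfl
  | succ k ih => simp [altWord, ih]

lemma altWord_pred_sublist (c : Bool) (k : ℕ) : (altWord c (k - 1)).Sublist (altWord (!c) k) := by
  cases k with
  | zero => simp [altWord]
  | succ k => simp [altWord]

lemma altWord_getElem_succ_ne (c : Bool) (k i : ℕ) (h : i + 1 < (altWord c k).length) :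
    (altWord c k)[i + 1] ≠ (altWord c k)[i] := by
  induction k generalizing c i with
  | zero => simp [altWord] at h
  | succ k ih =>
    cases i with
    | zero =>
      cases k with
      | zero => simp [altWord] at h
      | succ k => simp [altWord]
    | succ i =>
      simp only [altWord, List.getElem_cons_succ]
      exact ih _ _ (by simpa [altWord] using h)

/-- Any two consecutive letters of an alternating word include both values, so a greedy embedding
uses at most two of them per letter of `w`. -/
lemma sublist_altWord (c : Bool) (w : List Bool) (k : ℕ) (hk : 2 * w.length ≤ k) :
    w.Sublist (altWord c k) := by
  induction w generalizing k with
  | nil => simp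
  | cons a w ih =>
    obtain ⟨k, rfl⟩ : ∃ j, k = j + 2 := ⟨k - 2, by simp at hk; omega⟩
    have h := ih k (by simp at hk; omega)
    simp only [altWord, Bool.not_not]
    by_cases hac : a = c
    · subst hac
      exact (h.cons _).cons_cons a
    · have : a = !c := by cases a <;> cases c <;> simp_all
      subst this
      exact (h.cons_cons _).cons _

/-- The number of positive block lengths minus the number of zero block lengths. -/
def blockExcess (s : List ℕ) : ℤ := (s.map fun v => if v = 0 then (-1 : ℤ) else 1).sum

/-- A nonempty block prepends one letter to the alternating subsequence of the rest. Behind an empty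
block the subsequence starts with the wrong letter, and dropping that letter costs one. This is why
empty blocks count `-1`. -/
lemma exists_altWord_sublist_wordOf (c : Bool) (s : List ℕ) :
    ∃ k : ℕ, blockExcess s ≤ k ∧ (altWord c k).Sublist (wordOf c s) := by
  induction s generalizing c with
  | nil => exact ⟨0, by simp [blockExcess], by simp [altWord]⟩
  | cons v s ih =>
    obtain ⟨k, hk, hs⟩ := ih (!c)
    rcases Nat.eq_zero_or_pos v with rfl | hv
    · refine ⟨k - 1, ?_, ?_⟩
      · simp only [blockExcess, List.map_cons, List.sum_cons] at hk ⊢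
        simp only [if_true]
        omega
      · simpa [wordOf] using (altWord_pred_sublist c k).trans hs
    · refine ⟨k + 1, ?_, ?_⟩
      · simp only [blockExcess, List.map_cons, List.sum_cons] at hk ⊢
        rw [if_neg hv.ne']
        push_cast
        omega
      · obtain ⟨v, rfl⟩ := Nat.exists_eq_succ_of_ne_zero hv.ne'
        simp only [altWord, wordOf, List.replicate_succ, List.cons_append]
        exact (hs.trans (List.sublist_append_right _ _)).cons_cons c

lemma sublist_wordOf_of_le_blockExcess (c : Bool) (s : List ℕ) (w : List Bool)
    (h : (2 * w.length : ℤ) ≤ blockExcess s) : w.Sublist (wordOf c s) := by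
  obtain ⟨k, hk, hs⟩ := exists_altWord_sublist_wordOf c s
  exact (sublist_altWord c w k (by omega)).trans hs

/-! ### Averages over lists of block lengths -/

/-- The average of `F` over the lists of length `N` with entries `l - 1`, `l`, `l + 1`. -/
noncomputable def meanOver (l : ℕ) : ℕ → (List ℕ → ℝ) → ℝ
  | 0, F => F []
  | N + 1, F => (meanOver l N (fun s => F ((l - 1) :: s)) + meanOver l N (fun s => F (l :: s)) +
      meanOver l N (fun s => F ((l + 1) :: s))) / 3

lemma meanOver_mono {l N : ℕ} {F G : List ℕ → ℝ}
    (h : ∀ s : List ℕ, s.length = N → (∀ v ∈ s, v ≤ l + 1) → F s ≤ G s) :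
    meanOver l N F ≤ meanOver l N G := by
  induction N generalizing F G with
  | zero => exact h [] rfl (by simp)
  | succ N ih =>
    have key : ∀ a, a ≤ l + 1 →
        meanOver l N (fun s => F (a :: s)) ≤ meanOver l N (fun s => G (a :: s)) := by
      intro a ha
      refine ih fun s hs hs' => h _ (by simp [hs]) ?_
      intro v hv
      rcases List.mem_cons.1 hv with rfl | hv
      · exact ha
      · exact hs' v hv
    simp only [meanOver]
    linarith [key (l - 1) (by omega), key l (by omega), key (l + 1) le_rfl]

lemma meanOver_const (l N : ℕ) (a : ℝ) : meanOver l N (fun _ => a) = a := by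
  induction N with
  | zero => rfl
  | succ N ih => simp only [meanOver, ih]; ring

lemma meanOver_add (l N : ℕ) (F G : List ℕ → ℝ) :
    meanOver l N (fun s => F s + G s) = meanOver l N F + meanOver l N G := by
  induction N generalizing F G with
  | zero => rfl
  | succ N ih => simp only [meanOver, ih]; ring

lemma meanOver_mul_left (l N : ℕ) (a : ℝ) (F : List ℕ → ℝ) :
    meanOver l N (fun s => a * F s) = a * meanOver l N F := by
  induction N generalizing F with
  | zero => rfl
  | succ N ih => simp only [meanOver, ih]; ring

lemma meanOver_mul_right (l N : ℕ) (a : ℝ) (F : List ℕ → ℝ) :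
    meanOver l N (fun s => F s * a) = meanOver l N F * a := by
  simp only [mul_comm _ a]
  exact meanOver_mul_left l N a F

lemma meanOver_neg (l N : ℕ) (F : List ℕ → ℝ) :
    meanOver l N (fun s => - F s) = - meanOver l N F := by
  simpa using meanOver_mul_left l N (-1) F

lemma meanOver_sub (l N : ℕ) (F G : List ℕ → ℝ) :
    meanOver l N (fun s => F s - G s) = meanOver l N F - meanOver l N G := by
  simp only [sub_eq_add_neg, meanOver_add, meanOver_neg]

lemma meanOver_append (l M N : ℕ) (F : List ℕ → ℝ) :
    meanOver l (M + N) F = meanOver l M fun s => meanOver l N fun t => F (s ++ t) := by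
  induction M generalizing F with
  | zero => simp [meanOver]
  | succ M ih =>
    rw [show M + 1 + N = (M + N) + 1 by ring]
    simp only [meanOver, ih, List.cons_append]

lemma meanOver_le_const {l N : ℕ} {F : List ℕ → ℝ} {a : ℝ}
    (h : ∀ s : List ℕ, s.length = N → (∀ v ∈ s, v ≤ l + 1) → F s ≤ a) : meanOver l N F ≤ a := by
  rw [← meanOver_const l N a]
  exact meanOver_mono h

lemma meanOver_sum_map (l N : ℕ) (f : ℕ → ℝ) :
    meanOver l N (fun s => (s.map f).sum) = N * ((f (l - 1) + f l + f (l + 1)) / 3) := by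
  induction N with
  | zero => simp [meanOver]
  | succ N ih =>
    simp only [meanOver, List.map_cons, List.sum_cons, meanOver_add, meanOver_const, ih]
    push_cast
    ring

/-! ### Bounded differences -/

/-- Changing one entry, within `{0, …, l + 1}`, of a list of length `N` changes `F` by at most
`D`. -/
def HasBoundedDiff (l N : ℕ) (D : ℝ) (F : List ℕ → ℝ) : Prop :=
  ∀ p q : List ℕ, ∀ v v' : ℕ, p.length + q.length + 1 = N → v ≤ l + 1 → v' ≤ l + 1 →
    F (p ++ v :: q) ≤ F (p ++ v' :: q) + D

lemma HasBoundedDiff.cons {l N : ℕ} {D : ℝ} {F : List ℕ → ℝ} (h : HasBoundedDiff l (N + 1) D F)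
    (a : ℕ) : HasBoundedDiff l N D fun s => F (a :: s) := by
  intro p q v v' hN hv hv'
  exact h (a :: p) q v v' (by simp; omega) hv hv'

lemma HasBoundedDiff.neg {l N : ℕ} {D : ℝ} {F : List ℕ → ℝ} (h : HasBoundedDiff l N D F) :
    HasBoundedDiff l N D fun s => - F s := by
  intro p q v v' hN hv hv'
  linarith [h p q v' v hN hv' hv]

lemma hasBoundedDiff_sum_map (l N : ℕ) {f : ℕ → ℝ} {D : ℝ}
    (h : ∀ v v' : ℕ, v ≤ l + 1 → v' ≤ l + 1 → f v ≤ f v' + D) :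
    HasBoundedDiff l N D fun s => (s.map f).sum := by
  intro p q v v' _ hv hv'
  simp only [List.map_append, List.map_cons, List.sum_append, List.sum_cons]
  linarith [h v v' hv hv']

/-- By convexity, `exp` lies below its chord over `[-D, D]`; the right-hand side is that chord. Its
linear term vanishes on averaging a centred variable, as in Hoeffding's lemma. -/
lemma exp_le_cosh_add {D x : ℝ} (hD : 0 < D) (h1 : -D ≤ x) (h2 : x ≤ D) :
    Real.exp x ≤ Real.cosh D + x * (Real.sinh D / D) := by
  have h := convexOn_exp.2 (Set.mem_univ (-D)) (Set.mem_univ D)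
    (show 0 ≤ (D - x) / (2 * D) from div_nonneg (by linarith) (by linarith))
    (show 0 ≤ (D + x) / (2 * D) from div_nonneg (by linarith) (by linarith))
    (by field_simp; ring)
  simp only [smul_eq_mul] at h
  have e : (D - x) / (2 * D) * -D + (D + x) / (2 * D) * D = x := by field_simp; ring
  rw [e] at h
  refine h.trans (le_of_eq ?_)
  rw [Real.cosh_eq, Real.sinh_eq]
  field_simp
  ring

lemma exp_add_exp_add_exp_le {D a b c : ℝ} (hD : 0 < D) (h0 : a + b + c = 0)
    (ha : |a| ≤ D) (hb : |b| ≤ D) (hc : |c| ≤ D) :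
    (Real.exp a + Real.exp b + Real.exp c) / 3 ≤ Real.exp (D ^ 2 / 2) := by
  have ha' := exp_le_cosh_add hD (abs_le.1 ha).1 (abs_le.1 ha).2
  have hb' := exp_le_cosh_add hD (abs_le.1 hb).1 (abs_le.1 hb).2
  have hc' := exp_le_cosh_add hD (abs_le.1 hc).1 (abs_le.1 hc).2
  have e : a * (Real.sinh D / D) + b * (Real.sinh D / D) + c * (Real.sinh D / D) = 0 := by
    rw [← add_mul, ← add_mul, h0, zero_mul]
  linarith [Real.cosh_le_exp_half_sq D]

theorem meanOver_exp_le {l N : ℕ} {D : ℝ} (hD : 0 < D) {F : List ℕ → ℝ}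
    (hF : HasBoundedDiff l N D F) {r : ℝ} (hr : 0 ≤ r) :
    meanOver l N (fun s => Real.exp (r * (F s - meanOver l N F))) ≤
      Real.exp (N * (r * D) ^ 2 / 2) := by
  rcases hr.eq_or_lt with rfl | hr
  · simp [meanOver_const]
  induction N generalizing F with
  | zero => simp [meanOver]
  | succ N ih =>
    -- `A a` is the conditional mean given the first entry. The deviation splits into `A a - m`,
    -- handled by Hoeffding's lemma, and `F (a :: s) - A a`, handled by induction.
    set A := fun a => meanOver l N fun s => F (a :: s) with hA
    set m := meanOver l (N + 1) F with hm
    have hmA : m = (A (l - 1) + A l + A (l + 1)) / 3 := rfl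
    have hdiff : ∀ a b, a ≤ l + 1 → b ≤ l + 1 → A a ≤ A b + D := by
      intro a b ha hb
      rw [hA]
      simp only
      rw [← meanOver_const l N D, ← meanOver_add]
      refine meanOver_mono fun s hs _ => ?_
      exact hF [] s a b (by simp [hs]) ha hb
    have key : ∀ a, meanOver l N (fun s => Real.exp (r * (F (a :: s) - m))) ≤
        Real.exp (r * (A a - m)) * Real.exp (N * (r * D) ^ 2 / 2) := by
      intro a
      have h := ih (hF.cons a)
      have e : (fun s => Real.exp (r * (F (a :: s) - m))) =
          fun s => Real.exp (r * (A a - m)) * Real.exp (r * (F (a :: s) - A a)) := by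
        funext s
        rw [← Real.exp_add]
        congr 1
        ring
      rw [e, meanOver_mul_left]
      exact mul_le_mul_of_nonneg_left h (Real.exp_pos _).le
    have habs : ∀ a, a ∈ ({l - 1, l, l + 1} : Set ℕ) → |r * (A a - m)| ≤ r * D := by
      intro a ha
      have ha' : a ≤ l + 1 := by
        rcases ha with rfl | rfl | rfl <;> omega
      rw [abs_mul, abs_of_pos hr]
      refine mul_le_mul_of_nonneg_left (abs_le.2 ?_) hr.le
      have h1 := hdiff a (l - 1) ha' (by omega)
      have h2 := hdiff a l ha' (by omega)
      have h3 := hdiff a (l + 1) ha' le_rfl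
      have h1' := hdiff (l - 1) a (by omega) ha'
      have h2' := hdiff l a (by omega) ha'
      have h3' := hdiff (l + 1) a le_rfl ha'
      constructor <;> linarith
    have h3 := exp_add_exp_add_exp_le (mul_pos hr hD) (a := r * (A (l - 1) - m))
      (b := r * (A l - m)) (c := r * (A (l + 1) - m)) (by rw [hmA]; ring)
      (habs _ (by simp)) (habs _ (by simp)) (habs _ (by simp))
    have h4 := mul_le_mul_of_nonneg_right h3 (Real.exp_pos (N * (r * D) ^ 2 / 2)).le
    have e2 : Real.exp (((N + 1 : ℕ) : ℝ) * (r * D) ^ 2 / 2) =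
        Real.exp ((r * D) ^ 2 / 2) * Real.exp (N * (r * D) ^ 2 / 2) := by
      rw [← Real.exp_add]
      congr 1
      push_cast
      ring
    rw [e2]
    refine le_trans ?_ h4
    change (_ + _ + _) / 3 ≤ _
    linarith [key (l - 1), key l, key (l + 1)]

/-- The average of a function of two lists, of lengths `M` and `N`. -/
noncomputable def meanOver₂ (l M N : ℕ) (G : List ℕ → List ℕ → ℝ) : ℝ :=
  meanOver l M fun s => meanOver l N fun t => G s t

theorem meanOver₂_exp_le {l M N : ℕ} {D : ℝ} (hD : 0 < D) {G : List ℕ → List ℕ → ℝ}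
    (h₁ : ∀ t, HasBoundedDiff l M D fun s => G s t) (h₂ : ∀ s, HasBoundedDiff l N D (G s))
    {r : ℝ} (hr : 0 ≤ r) :
    meanOver₂ l M N (fun s t => Real.exp (r * (G s t - meanOver₂ l M N G))) ≤
      Real.exp ((M + N) * (r * D) ^ 2 / 2) := by
  set m := meanOver₂ l M N G with hm
  set g := fun s => meanOver l N (G s) with hg
  have hgm : meanOver l M g = m := rfl
  -- Averaging out the second list preserves bounded differences in the first, so the one-list
  -- inequality applies twice.
  have hgd : HasBoundedDiff l M D g := by
    intro p q v v' hM hv hv'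
    rw [hg]
    simp only
    rw [← meanOver_const l N D, ← meanOver_add]
    refine meanOver_mono fun t _ _ => ?_
    exact h₁ t p q v v' hM hv hv'
  have key : ∀ s, meanOver l N (fun t => Real.exp (r * (G s t - m))) ≤
      Real.exp (r * (g s - m)) * Real.exp (N * (r * D) ^ 2 / 2) := by
    intro s
    have h := meanOver_exp_le hD (h₂ s) hr
    have e : (fun t => Real.exp (r * (G s t - m))) =
        fun t => Real.exp (r * (g s - m)) * Real.exp (r * (G s t - g s)) := by
      funext t
      rw [← Real.exp_add]
      congr 1
      ring
    rw [e, meanOver_mul_left]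
    exact mul_le_mul_of_nonneg_left h (Real.exp_pos _).le
  have h1 := meanOver_exp_le hD hgd hr
  rw [hgm] at h1
  calc meanOver₂ l M N (fun s t => Real.exp (r * (G s t - m)))
      ≤ meanOver l M (fun s => Real.exp (r * (g s - m)) * Real.exp (N * (r * D) ^ 2 / 2)) :=
        meanOver_mono fun s _ _ => key s
    _ ≤ Real.exp (M * (r * D) ^ 2 / 2) * Real.exp (N * (r * D) ^ 2 / 2) := by
        rw [meanOver_mul_right]
        exact mul_le_mul_of_nonneg_right h1 (Real.exp_pos _).le
    _ = Real.exp ((M + N) * (r * D) ^ 2 / 2) := by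
        rw [← Real.exp_add]
        congr 1
        ring

/-- An exponential weight that is at least `1` where `G` exceeds its mean by `x`, and whose mean is
small: the bounded differences inequality. -/
theorem exists_weight_of_hasBoundedDiff {l M N : ℕ} (hMN : 0 < M + N) {D : ℝ} (hD : 0 < D)
    {G : List ℕ → List ℕ → ℝ} (h₁ : ∀ t, HasBoundedDiff l M D fun s => G s t)
    (h₂ : ∀ s, HasBoundedDiff l N D (G s)) {x : ℝ} (hx : 0 ≤ x) :
    ∃ F : List ℕ → List ℕ → ℝ, (∀ s t, 0 ≤ F s t) ∧
      (∀ s t, meanOver₂ l M N G + x ≤ G s t → 1 ≤ F s t) ∧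
      meanOver₂ l M N F ≤ Real.exp (-(x ^ 2 / (2 * (M + N) * D ^ 2))) := by
  have hK : (0 : ℝ) < M + N := by exact_mod_cast hMN
  -- The minimiser of the Chernoff exponent `-r x + (M + N) (r D)² / 2`.
  set r := x / ((M + N) * D ^ 2) with hr
  have hr0 : 0 ≤ r := by positivity
  refine ⟨fun s t => Real.exp (-(r * x)) * Real.exp (r * (G s t - meanOver₂ l M N G)),
    fun s t => by positivity, fun s t h => ?_, ?_⟩
  · simp only [← Real.exp_add]
    refine Real.one_le_exp ?_
    have := mul_nonneg hr0 (sub_nonneg.2 h)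
    linarith
  · have h := mul_le_mul_of_nonneg_left (meanOver₂_exp_le hD h₁ h₂ hr0)
      (Real.exp_pos (-(r * x))).le
    have e : meanOver₂ l M N (fun s t => Real.exp (-(r * x)) *
        Real.exp (r * (G s t - meanOver₂ l M N G))) = Real.exp (-(r * x)) *
        meanOver₂ l M N (fun s t => Real.exp (r * (G s t - meanOver₂ l M N G))) := by
      simp only [meanOver₂, meanOver_mul_left]
    rw [e]
    refine h.trans (le_of_eq ?_)
    rw [← Real.exp_add]
    congr 1
    rw [hr]
    field_simp
    ring

/-! ### Mean values of the basic functionals -/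

lemma cast_list_sum (s : List ℕ) : (s.sum : ℝ) = (s.map fun v : ℕ => (v : ℝ)).sum := by
  induction s with
  | nil => simp
  | cons v s ih => simp [ih]

lemma cast_blockExcess (s : List ℕ) :
    (blockExcess s : ℝ) = (s.map fun v => if v = 0 then (-1 : ℝ) else 1).sum := by
  induction s with
  | nil => simp [blockExcess]
  | cons v s ih =>
    rw [List.map_cons, List.sum_cons, ← ih]
    simp only [blockExcess, List.map_cons, List.sum_cons]
    push_cast
    split_ifs <;> simp

lemma meanOver_sum {l : ℕ} (hl : 0 < l) (N : ℕ) :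
    meanOver l N (fun s => (s.sum : ℝ)) = N * l := by
  simp only [cast_list_sum]
  rw [meanOver_sum_map, Nat.cast_sub (by omega)]
  push_cast
  ring

/-- The worst case is `l = 1`, where the three lengths contribute `-1`, `1`, `1`. -/
lemma le_meanOver_blockExcess {l : ℕ} (hl : 0 < l) (N : ℕ) :
    (N : ℝ) / 3 ≤ meanOver l N (fun s => (blockExcess s : ℝ)) := by
  simp only [cast_blockExcess]
  rw [meanOver_sum_map, if_neg hl.ne', if_neg (Nat.succ_ne_zero l)]
  rw [div_eq_mul_inv]
  refine mul_le_mul_of_nonneg_left ?_ (Nat.cast_nonneg N)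
  split_ifs <;> norm_num

lemma hasBoundedDiff_sum (l N : ℕ) :
    HasBoundedDiff l N (l + 1) fun s => (s.sum : ℝ) := by
  simp only [cast_list_sum]
  refine hasBoundedDiff_sum_map l N fun v v' hv _ => ?_
  have h1 : (v : ℝ) ≤ l + 1 := by exact_mod_cast hv
  have h2 : (0 : ℝ) ≤ v' := Nat.cast_nonneg v'
  linarith

lemma hasBoundedDiff_blockExcess (l N : ℕ) :
    HasBoundedDiff l N 2 fun s => (blockExcess s : ℝ) := by
  simp only [cast_blockExcess]
  refine hasBoundedDiff_sum_map l N fun v v' _ _ => ?_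
  split_ifs <;> norm_num

lemma hasBoundedDiff_lcs_left (l N : ℕ) (c : Bool) (u : List Bool) :
    HasBoundedDiff l N (l + 1) fun s => (lcs (wordOf c s) u : ℝ) := by
  intro p q v v' _ hv _
  have h := lcs_wordOf_le_of_replace c p q v v' u
  have h' : lcs (wordOf c (p ++ v :: q)) u ≤ lcs (wordOf c (p ++ v' :: q)) u + (l + 1) := by omega
  show (lcs (wordOf c (p ++ v :: q)) u : ℝ) ≤ lcs (wordOf c (p ++ v' :: q)) u + (l + 1)
  exact_mod_cast h'

lemma hasBoundedDiff_lcs_right (l N : ℕ) (c : Bool) (u : List Bool) :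
    HasBoundedDiff l N (l + 1) fun s => (lcs u (wordOf c s) : ℝ) := by
  simp only [lcs_comm u]
  exact hasBoundedDiff_lcs_left l N c u

/-- The mean length of a longest common subsequence of a word with `M` blocks and a word with `N`
blocks. -/
noncomputable def meanLcs (l : ℕ) (c c' : Bool) (M N : ℕ) : ℝ :=
  meanOver₂ l M N fun s t => (lcs (wordOf c s) (wordOf c' t) : ℝ)

lemma meanLcs_le {l : ℕ} (hl : 0 < l) (c c' : Bool) (M N : ℕ) : meanLcs l c c' M N ≤ M * l := by
  rw [← meanOver_sum hl]
  refine meanOver_mono fun s _ _ => meanOver_le_const fun t _ _ => ?_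
  rw [← length_wordOf c]
  exact Nat.cast_le.2 (lcs_le_left _ _)

/-- Superadditivity by concatenation. With an even number of blocks in front, the appended words
start again with `c` and `c'`, so the same function `meanLcs l c c'` appears throughout. -/
lemma meanLcs_add_le (l : ℕ) (c c' : Bool) {M N : ℕ} (hM : Even M) (hN : Even N) (M' N' : ℕ) :
    meanLcs l c c' M N + meanLcs l c c' M' N' ≤ meanLcs l c c' (M + M') (N + N') := by
  have h : meanLcs l c c' M N + meanLcs l c c' M' N' =
      meanOver l M fun s => meanOver l M' fun s' => meanOver l N fun t => meanOver l N' fun t' =>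
        (lcs (wordOf c s) (wordOf c' t) : ℝ) + lcs (wordOf c s') (wordOf c' t') := by
    simp only [meanOver_add, meanOver_const, meanLcs, meanOver₂]
  rw [h]
  simp only [meanLcs, meanOver₂, meanOver_append]
  refine meanOver_mono fun s hs _ => meanOver_mono fun s' _ _ => meanOver_mono fun t ht _ =>
    meanOver_mono fun t' _ _ => ?_
  rw [wordOf_append_of_even c (hs ▸ hM), wordOf_append_of_even c' (ht ▸ hN)]
  exact_mod_cast lcs_add_le_append _ _ _ _

lemma mul_meanLcs_add_le (l : ℕ) (c c' : Bool) {M N : ℕ} (hM : Even M) (hN : Even N) (M' N' q : ℕ) :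
    q * meanLcs l c c' M N + meanLcs l c c' M' N' ≤ meanLcs l c c' (q * M + M') (q * N + N') := by
  induction q with
  | zero => simp
  | succ q ih =>
    have h := meanLcs_add_le l c c' hM hN (q * M + M') (q * N + N')
    rw [show (q + 1) * M + M' = M + (q * M + M') by ring,
      show (q + 1) * N + N' = N + (q * N + N') by ring]
    push_cast
    linarith

/-- A word with sufficiently many more blocks contains most letters of the other word. -/
lemma le_meanLcs {l : ℕ} (hl : 0 < l) (c c' : Bool) {N : ℕ} (hN : 0 < N) :
    N * l * (1 - Real.exp (-(N / 24))) ≤ meanLcs l c c' (12 * (l + 1) * N) N := by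
  set M := 12 * (l + 1) * N with hM
  have hMR : (M : ℝ) = 12 * (l + 1) * N := by rw [hM]; push_cast; ring
  have hN' : (0 : ℝ) < N := by exact_mod_cast hN
  have hM0 : 0 < M := by positivity
  -- The second list is a dummy of length `0`. The mean excess is at least `M / 3`; allowing a
  -- deviation of `M / 6` leaves `M / 6 = 2 (l + 1) N`, twice the maximal length of the second word.
  obtain ⟨F, hF0, hF1, hF2⟩ := exists_weight_of_hasBoundedDiff (l := l) (M := M) (N := 0)
    (by omega) (D := 2) (by norm_num) (G := fun s _ => -(blockExcess s : ℝ))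
    (fun _ => (hasBoundedDiff_blockExcess l M).neg)
    (fun _ => fun p q v v' h => by omega) (x := M / 6) (by positivity)
  have hmean : meanOver₂ l M 0 (fun s _ => -(blockExcess s : ℝ)) ≤ - (M / 3) := by
    simp only [meanOver₂, meanOver_const, meanOver_neg]
    linarith [le_meanOver_blockExcess hl M]
  -- `1 - F` replaces the indicator of containment: it is at most `1`, and at most `0` when the
  -- excess is too small. The left-hand side is a product of functions of `s` and of `t`, so its
  -- average factorises.
  have key : ∀ s t : List ℕ, t.length = N → (∀ v ∈ t, v ≤ l + 1) →
      (t.sum : ℝ) * (1 - F s []) ≤ lcs (wordOf c s) (wordOf c' t) := by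
    intro s t ht ht'
    by_cases h : (2 * (wordOf c' t).length : ℤ) ≤ blockExcess s
    · have h1 := length_le_lcs (sublist_wordOf_of_le_blockExcess c s _ h)
        (List.Sublist.refl (wordOf c' t))
      rw [length_wordOf] at h1
      have h2 : (t.sum : ℝ) ≤ lcs (wordOf c s) (wordOf c' t) := by exact_mod_cast h1
      refine le_trans ?_ h2
      nlinarith [hF0 s [], (Nat.cast_nonneg t.sum : (0 : ℝ) ≤ t.sum)]
    · have hs : t.sum ≤ N * (l + 1) := by
        rw [← ht, ← smul_eq_mul]
        exact List.sum_le_card_nsmul t _ ht'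
      have hs' : (t.sum : ℝ) ≤ N * (l + 1) := by exact_mod_cast hs
      rw [length_wordOf] at h
      have h1 : (blockExcess s : ℝ) ≤ 2 * t.sum := by
        have := Int.cast_le (R := ℝ).2 (not_le.1 h).le
        rwa [Int.cast_mul, Int.cast_natCast, Int.cast_ofNat] at this
      have h2 := hF1 s [] (by linarith)
      refine le_trans ?_ (Nat.cast_nonneg _)
      exact mul_nonpos_of_nonneg_of_nonpos (Nat.cast_nonneg _) (by linarith)
  have h1 : meanOver l M (fun s => meanOver l N fun t => (t.sum : ℝ) * (1 - F s [])) ≤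
      meanLcs l c c' M N :=
    meanOver_mono fun s _ _ => meanOver_mono fun t ht ht' => key s t ht ht'
  refine le_trans ?_ h1
  simp only [meanOver_mul_right, meanOver_mul_left, meanOver_sum hl, meanOver_sub, meanOver_const]
  refine mul_le_mul_of_nonneg_left ?_ (by positivity)
  have h2 : meanOver l M (fun s => F s []) ≤ Real.exp (-(N / 24)) := by
    refine le_trans hF2 (Real.exp_le_exp.2 ?_)
    rw [neg_le_neg_iff, hMR, le_div_iff₀ (by push_cast; positivity)]
    push_cast
    have hl' : (0 : ℝ) ≤ l := Nat.cast_nonneg l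
    nlinarith [mul_pos hN' hN', mul_nonneg hl' (mul_pos hN' hN').le,
      mul_nonneg (mul_nonneg hl' hl') (mul_pos hN' hN').le]
  linarith

/-! ### The mean gap -/

/-- Fekete's lemma for the negated means; the factor `2` keeps all block numbers even. -/
lemma exists_tendsto_meanLcs_div {l : ℕ} (hl : 0 < l) (c c' : Bool) (a b : ℕ) :
    ∃ g : ℝ, Filter.Tendsto (fun k : ℕ => meanLcs l c c' (2 * (a * k)) (2 * (b * k)) / k)
      Filter.atTop (nhds g) := by
  have hsub : Subadditive fun k : ℕ => -meanLcs l c c' (2 * (a * k)) (2 * (b * k)) := by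
    intro i j
    have h := meanLcs_add_le l c c' (even_two_mul (a * i)) (even_two_mul (b * i))
      (2 * (a * j)) (2 * (b * j))
    simp only [Nat.mul_add] at h ⊢
    linarith
  have hb : BddBelow (Set.range fun k : ℕ =>
      -meanLcs l c c' (2 * (a * k)) (2 * (b * k)) / (k : ℝ)) := by
    refine ⟨-(2 * a * l), ?_⟩
    rintro _ ⟨k, rfl⟩
    rcases Nat.eq_zero_or_pos k with rfl | hk
    · simp only [Nat.cast_zero, div_zero]
      have : (0 : ℝ) ≤ 2 * a * l := by positivity
      linarith
    · have hk' : (0 : ℝ) < k := by exact_mod_cast hk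
      have h := meanLcs_le hl c c' (2 * (a * k)) (2 * (b * k))
      simp only
      rw [le_div_iff₀ hk']
      push_cast at h
      nlinarith
  refine ⟨-hsub.lim, ?_⟩
  have h := (hsub.tendsto_lim hb).neg
  refine h.congr fun k => ?_
  ring

/-- Using all blocks of the first word increases the mean linearly. -/
theorem eventually_meanLcs_add_le {l : ℕ} (hl : 0 < l) (a : ℕ) :
    ∃ γ : ℝ, 0 < γ ∧ ∀ c c' : Bool, ∀ᶠ k : ℕ in Filter.atTop,
      meanLcs l c c' (2 * (a * k)) (2 * ((a + 1) * k)) + γ * k ≤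
        meanLcs l c c' (2 * ((a + 1) * k)) (2 * ((a + 1) * k)) := by
  -- Chosen so that `q a + 12 (l + 1) (a + 1) = (q + 1) (a + 1)`: after adding the extra pair to `q`
  -- unbalanced ones, both words have the same number of blocks.
  set q := (12 * l + 11) * (a + 1) with hq
  have hl' : (0 : ℝ) < l := by exact_mod_cast hl
  have hq0 : (0 : ℝ) < (q : ℝ) + 1 := by positivity
  refine ⟨l / (2 * (q + 1)), by positivity, fun c c' => ?_⟩
  set u := fun k : ℕ => meanLcs l c c' (2 * (a * k)) (2 * ((a + 1) * k)) with hu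
  set w := fun k : ℕ => meanLcs l c c' (2 * ((a + 1) * k)) (2 * ((a + 1) * k)) with hw
  obtain ⟨g, hg⟩ := exists_tendsto_meanLcs_div hl c c' a (a + 1)
  obtain ⟨g', hg'⟩ := exists_tendsto_meanLcs_div hl c c' (a + 1) (a + 1)
  have hgle : g ≤ 2 * a * l := by
    refine le_of_tendsto hg ?_
    filter_upwards [Filter.eventually_gt_atTop 0] with k hk
    have hk' : (0 : ℝ) < k := by exact_mod_cast hk
    have h := meanLcs_le hl c c' (2 * (a * k)) (2 * ((a + 1) * k))
    rw [div_le_iff₀ hk']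
    push_cast at h
    nlinarith
  -- With this threshold the error in `le_meanLcs` costs at most `l k` out of `2 (a + 1) l k`,
  -- leaving the `(2 a + 1) l k` used in `hstep`.
  have hexp : ∀ᶠ k : ℕ in Filter.atTop,
      Real.exp (-((2 * ((a + 1) * k) : ℕ) / 24)) < 1 / (2 * (a + 1)) := by
    have hlim : Filter.Tendsto (fun k : ℕ => Real.exp (-((2 * ((a + 1) * k) : ℕ) / 24 : ℝ)))
        Filter.atTop (nhds 0) := by
      refine Real.tendsto_exp_neg_atTop_nhds_zero.comp ?_
      refine Filter.Tendsto.atTop_div_const (by norm_num) ?_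
      refine tendsto_natCast_atTop_atTop.comp ?_
      refine Filter.tendsto_atTop_mono (fun k => ?_) Filter.tendsto_id
      simp only [id]
      nlinarith
    exact hlim.eventually_lt_const (by positivity)
  have hstep : ∀ᶠ k : ℕ in Filter.atTop,
      q * (u k / k) + l * (2 * a + 1) ≤ (q + 1) * (w ((q + 1) * k) / ((q + 1) * k : ℕ)) := by
    filter_upwards [hexp, Filter.eventually_gt_atTop 0] with k hk hk0
    have hk' : (0 : ℝ) < k := by exact_mod_cast hk0
    have h1 := le_meanLcs hl c c' (N := 2 * ((a + 1) * k)) (by positivity)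
    have h2 := mul_meanLcs_add_le l c c' (even_two_mul (a * k)) (even_two_mul ((a + 1) * k))
      (12 * (l + 1) * (2 * ((a + 1) * k))) (2 * ((a + 1) * k)) q
    rw [show q * (2 * (a * k)) + 12 * (l + 1) * (2 * ((a + 1) * k)) =
        2 * ((a + 1) * ((q + 1) * k)) by rw [hq]; ring,
      show q * (2 * ((a + 1) * k)) + 2 * ((a + 1) * k) = 2 * ((a + 1) * ((q + 1) * k)) by ring]
      at h2
    have h3 : l * (2 * a + 1) * (k : ℝ) ≤
        (2 * ((a + 1) * k) : ℕ) * l * (1 - Real.exp (-((2 * ((a + 1) * k) : ℕ) / 24))) := by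
      set e := Real.exp (-((2 * ((a + 1) * k) : ℕ) / 24 : ℝ))
      rw [lt_div_iff₀ (by positivity)] at hk
      push_cast
      have : l * k * (2 * a + 1 : ℝ) ≤ l * k * (2 * (a + 1) - e * (2 * (a + 1))) :=
        mul_le_mul_of_nonneg_left (by linarith) (by positivity)
      linarith
    have h4 : q * u k + l * (2 * a + 1) * k ≤ w ((q + 1) * k) := by
      simp only [hu, hw]
      linarith
    have e1 : (q + 1) * (w ((q + 1) * k) / ((q + 1) * k : ℕ)) = w ((q + 1) * k) / k := by
      push_cast
      field_simp
    rw [e1, le_div_iff₀ hk']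
    have e2 : (q * (u k / k) + l * (2 * a + 1)) * k = q * u k + l * (2 * a + 1) * k := by
      field_simp
    rw [e2]
    exact h4
  have hlim2 : Filter.Tendsto (fun k : ℕ => (q + 1) * (w ((q + 1) * k) / ((q + 1) * k : ℕ)))
      Filter.atTop (nhds ((q + 1) * g')) := by
    refine Filter.Tendsto.const_mul _ (hg'.comp ?_)
    exact Filter.tendsto_id.const_mul_atTop' (Nat.succ_pos q)
  have hineq : q * g + l * (2 * a + 1) ≤ (q + 1) * g' :=
    le_of_tendsto_of_tendsto ((hg.const_mul _).add_const _) hlim2 hstep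
  -- Insert `g ≤ 2 a l` in `hineq` to get `g' - g ≥ l / (q + 1)`; half of it is kept so that the
  -- inequality is strict and passes to large finite `k`.
  have hgap : l / (2 * ((q : ℝ) + 1)) < g' - g := by
    rw [div_lt_iff₀ (by positivity)]
    nlinarith
  filter_upwards [(hg'.sub hg).eventually_const_lt hgap, Filter.eventually_gt_atTop 0] with k hk hk0
  have hk' : (0 : ℝ) < k := by exact_mod_cast hk0
  rw [← sub_div, lt_div_iff₀ hk'] at hk
  linarith

/-! ### The law of the block lengths -/

/-- The list of the first `N` terms of `B`. -/
def blockLengths (B : ℕ → ℕ) (N : ℕ) : List ℕ := (List.range N).map B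

lemma length_blockLengths (B : ℕ → ℕ) (N : ℕ) : (blockLengths B N).length = N := by
  simp [blockLengths]

lemma blockLengths_succ (B : ℕ → ℕ) (N : ℕ) :
    blockLengths B (N + 1) = blockLengths B N ++ [B N] := by
  simp [blockLengths, List.range_succ]

lemma blockLengths_eq_iff (B : ℕ → ℕ) {N : ℕ} {s : List ℕ} (hs : s.length = N) :
    blockLengths B N = s ↔ ∀ i ∈ Finset.range N, B i = s.getD i 0 := by
  subst hs
  constructor
  · intro h i hi
    rw [← h]
    have := Finset.mem_range.1 hi
    simp [blockLengths, this]
  · intro h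
    refine List.ext_getElem (by simp [blockLengths]) fun i h1 h2 => ?_
    have := h i (Finset.mem_range.2 h2)
    simp [blockLengths, this, h2]

section

variable {Ω : Type*} [MeasurableSpace Ω] {P : Measure Ω}

lemma IsBlockModel.ae_mem [IsProbabilityMeasure P] {l : ℕ} (hl : 0 < l) {c : Ω → Bool}
    {B : ℕ → Ω → ℕ} (h : IsBlockModel P l c B) :
    ∀ᵐ ω ∂P, ∀ i, B i ω ∈ ({l - 1, l, l + 1} : Set ℕ) := by
  rw [ae_all_iff]
  intro i
  have hm : ∀ m, MeasurableSet {ω | B i ω = m} := fun m =>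
    h.measurable_B i (measurableSet_singleton m)
  have h1 : {ω | B i ω ∈ ({l - 1, l, l + 1} : Set ℕ)} =
      {ω | B i ω = l - 1} ∪ ({ω | B i ω = l} ∪ {ω | B i ω = l + 1}) := by
    ext ω
    simp
  have h2 : P {ω | B i ω ∈ ({l - 1, l, l + 1} : Set ℕ)} = 1 := by
    rw [h1, measure_union _ ((hm _).union (hm _)), measure_union _ (hm _),
      h.law_B i _ (by simp), h.law_B i _ (by simp), h.law_B i _ (by simp), ← add_assoc]
    · exact ENNReal.add_thirds 1
    · rw [Set.disjoint_left]
      intro ω h3 h4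
      simp only [Set.mem_ofPred_eq] at h3 h4
      omega
    · rw [Set.disjoint_left]
      intro ω h3 h4
      simp only [Set.mem_ofPred_eq, Set.mem_union] at h3 h4
      omega
  exact (mem_ae_iff_prob_eq_one (h1 ▸ (hm _).union ((hm _).union (hm _)))).2 h2

lemma IsBlockModel.measure_blockLengths_eq {l : ℕ} {c : Ω → Bool}
    {B : ℕ → Ω → ℕ} (h : IsBlockModel P l c B) {N : ℕ} {s : List ℕ} (hs : s.length = N)
    (hs' : ∀ v ∈ s, v ∈ ({l - 1, l, l + 1} : Set ℕ)) :
    P {ω | blockLengths (fun i => B i ω) N = s} = (1 / 3) ^ N := by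
  have e : {ω | blockLengths (fun i => B i ω) N = s} =
      ⋂ i ∈ Finset.range N, B i ⁻¹' {s.getD i 0} := by
    ext ω
    simp [blockLengths_eq_iff _ hs]
  rw [e, h.indep_B.measure_inter_preimage_eq_mul (Finset.range N)
    (fun i _ => measurableSet_singleton _)]
  rw [Finset.prod_congr rfl (g := fun _ => (1 / 3 : ENNReal)), Finset.prod_const, Finset.card_range]
  intro i hi
  have hi' : i < s.length := hs ▸ Finset.mem_range.1 hi
  refine h.law_B i _ (hs' _ ?_)
  rw [List.getD_eq_getElem _ _ hi']
  exact List.getElem_mem hi'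

/-- A union bound over the `3 ^ N` admissible lists, with the sum of the bounds written as `3 ^ N`
times their average. -/
lemma measureReal_exists_list_le [IsFiniteMeasure P] {l N : ℕ} {Q : List ℕ → Set Ω}
    {F : List ℕ → ℝ}
    (h : ∀ s : List ℕ, s.length = N → (∀ v ∈ s, v ∈ ({l - 1, l, l + 1} : Set ℕ)) →
      P.real (Q s) ≤ F s) :
    P.real {ω | ∃ s : List ℕ, s.length = N ∧ (∀ v ∈ s, v ∈ ({l - 1, l, l + 1} : Set ℕ)) ∧ ω ∈ Q s} ≤
      3 ^ N * meanOver l N F := by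
  induction N generalizing Q F with
  | zero =>
    have e : {ω | ∃ s : List ℕ, s.length = 0 ∧ (∀ v ∈ s, v ∈ ({l - 1, l, l + 1} : Set ℕ)) ∧
        ω ∈ Q s} = Q [] := by
      ext ω
      constructor
      · rintro ⟨s, h1, -, h3⟩
        rwa [List.length_eq_zero_iff.1 h1] at h3
      · exact fun h => ⟨[], rfl, by simp, h⟩
    rw [e]
    simpa [meanOver] using h [] rfl (by simp)
  | succ N ih =>
    set R := fun a => {ω | ∃ s : List ℕ, s.length = N ∧
      (∀ v ∈ s, v ∈ ({l - 1, l, l + 1} : Set ℕ)) ∧ ω ∈ Q (a :: s)} with hR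
    have key : ∀ a ∈ ({l - 1, l, l + 1} : Set ℕ),
        P.real (R a) ≤ 3 ^ N * meanOver l N fun s => F (a :: s) := by
      intro a ha
      refine ih fun s hs hs' => h _ (by simp [hs]) ?_
      intro v hv
      rcases List.mem_cons.1 hv with rfl | hv
      · exact ha
      · exact hs' v hv
    have hsub : {ω | ∃ s : List ℕ, s.length = N + 1 ∧
        (∀ v ∈ s, v ∈ ({l - 1, l, l + 1} : Set ℕ)) ∧ ω ∈ Q s} ⊆ R (l - 1) ∪ R l ∪ R (l + 1) := by
      rintro ω ⟨s, h1, h2, h3⟩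
      obtain ⟨a, t, rfl⟩ := List.exists_cons_of_length_eq_add_one h1
      have ht : ω ∈ R a := ⟨t, by simpa using h1, fun v hv => h2 v (List.mem_cons_of_mem a hv), h3⟩
      rcases h2 a List.mem_cons_self with rfl | rfl | rfl
      · exact Or.inl (Or.inl ht)
      · exact Or.inl (Or.inr ht)
      · exact Or.inr ht
    refine (measureReal_mono hsub).trans ((measureReal_union_le _ _).trans
      ((add_le_add_left (measureReal_union_le _ _) _).trans ?_))
    have := key (l - 1) (by simp)
    have := key l (by simp)
    have := key (l + 1) (by simp)
    simp only [meanOver, pow_succ]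
    linarith

variable {l : ℕ} {cX cY : Ω → Bool} {BX BY : ℕ → Ω → ℕ}

lemma measureReal_blockLengths_eq_eq (hX : IsBlockModel P l cX BX) (hY : IsBlockModel P l cY BY)
    (hXY : IndepFun (fun ω => (cX ω, fun i => BX i ω)) (fun ω => (cY ω, fun i => BY i ω)) P)
    {M N : ℕ} {s t : List ℕ} (hs : s.length = M) (ht : t.length = N)
    (hs' : ∀ v ∈ s, v ∈ ({l - 1, l, l + 1} : Set ℕ))
    (ht' : ∀ v ∈ t, v ∈ ({l - 1, l, l + 1} : Set ℕ)) :
    P.real ({ω | blockLengths (fun i => BX i ω) M = s} ∩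
      {ω | blockLengths (fun i => BY i ω) N = t}) = (1 / 3) ^ M * (1 / 3) ^ N := by
  have hmeas : ∀ (K : ℕ) (r : List ℕ), r.length = K →
      MeasurableSet {p : Bool × (ℕ → ℕ) | blockLengths p.2 K = r} := by
    intro K r hr
    have e : {p : Bool × (ℕ → ℕ) | blockLengths p.2 K = r} =
        ⋂ i ∈ Finset.range K, (fun p : Bool × (ℕ → ℕ) => p.2 i) ⁻¹' {r.getD i 0} := by
      ext p
      simp [blockLengths_eq_iff _ hr]
    rw [e]
    exact Finset.measurableSet_biInter _ fun i _ =>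
      ((measurable_pi_apply i).comp measurable_snd) (measurableSet_singleton _)
  have h := hXY.measure_inter_preimage_eq_mul _ _ (hmeas M s hs) (hmeas N t ht)
  simp only [Set.preimage_ofPred_eq] at h
  rw [hX.measure_blockLengths_eq hs hs', hY.measure_blockLengths_eq ht ht'] at h
  rw [measureReal_def, h]
  simp

/-- Markov's inequality for an event that depends on finitely many block lengths. -/
lemma measureReal_blockLengths_le [IsProbabilityMeasure P] (hl : 0 < l) (hX : IsBlockModel P l cX BX)
    (hY : IsBlockModel P l cY BY)
    (hXY : IndepFun (fun ω => (cX ω, fun i => BX i ω)) (fun ω => (cY ω, fun i => BY i ω)) P)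
    (M N : ℕ) {S : List ℕ → List ℕ → Prop} {F : List ℕ → List ℕ → ℝ} (hF0 : ∀ s t, 0 ≤ F s t)
    (hF1 : ∀ s t, S s t → 1 ≤ F s t) :
    P.real {ω | S (blockLengths (fun i => BX i ω) M) (blockLengths (fun i => BY i ω) N)} ≤
      meanOver₂ l M N F := by
  -- The first set is everything or empty. Hence `Q s t` has probability `3 ^ (-M - N)` or `0`, and
  -- in both cases at most that number times `F s t`.
  set Q := fun s t => {ω | S s t} ∩ ({ω | blockLengths (fun i => BX i ω) M = s} ∩
      {ω | blockLengths (fun i => BY i ω) N = t}) with hQ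
  have h1 : ∀ s : List ℕ, s.length = M → (∀ v ∈ s, v ∈ ({l - 1, l, l + 1} : Set ℕ)) →
      P.real {ω | ∃ t : List ℕ, t.length = N ∧ (∀ v ∈ t, v ∈ ({l - 1, l, l + 1} : Set ℕ)) ∧
        ω ∈ Q s t} ≤ 3 ^ N * meanOver l N fun t => ((1 / 3) ^ M * (1 / 3) ^ N) * F s t := by
    intro s hs hs'
    refine measureReal_exists_list_le fun t ht ht' => ?_
    by_cases hst : S s t
    · refine (measureReal_mono Set.inter_subset_right).trans ?_
      rw [measureReal_blockLengths_eq_eq hX hY hXY hs ht hs' ht']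
      exact le_mul_of_one_le_right (by positivity) (hF1 s t hst)
    · have : Q s t = ∅ := by simp [hQ, hst]
      rw [this, measureReal_empty]
      exact mul_nonneg (by positivity) (hF0 s t)
  have h2 := measureReal_exists_list_le (P := P) h1
  have e : 3 ^ M * meanOver l M (fun s => 3 ^ N * meanOver l N fun t =>
      ((1 / 3) ^ M * (1 / 3) ^ N) * F s t) = meanOver₂ l M N F := by
    simp only [meanOver_mul_left, meanOver₂]
    simp only [one_div, inv_pow]
    field_simp
  rw [e] at h2
  refine le_trans ?_ h2
  rw [measureReal_def, measureReal_def]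
  refine ENNReal.toReal_mono (measure_ne_top _ _) (measure_mono_ae ?_)
  filter_upwards [hX.ae_mem hl, hY.ae_mem hl] with ω hωX hωY hω
  refine ⟨blockLengths (fun i => BX i ω) M, length_blockLengths _ _, ?_,
    blockLengths (fun i => BY i ω) N, length_blockLengths _ _, ?_, hω, rfl, rfl⟩
  · intro v hv
    obtain ⟨i, -, rfl⟩ := List.mem_map.1 hv
    exact hωX i
  · intro v hv
    obtain ⟨i, -, rfl⟩ := List.mem_map.1 hv
    exact hωY i

theorem measureReal_mean_add_le [IsProbabilityMeasure P] (hl : 0 < l) (hX : IsBlockModel P l cX BX)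
    (hY : IsBlockModel P l cY BY)
    (hXY : IndepFun (fun ω => (cX ω, fun i => BX i ω)) (fun ω => (cY ω, fun i => BY i ω)) P)
    {M N : ℕ} (hMN : 0 < M + N) {D : ℝ} (hD : 0 < D)
    {G : List ℕ → List ℕ → ℝ} (h₁ : ∀ t, HasBoundedDiff l M D fun s => G s t)
    (h₂ : ∀ s, HasBoundedDiff l N D (G s)) {x : ℝ} (hx : 0 ≤ x) :
    P.real {ω | meanOver₂ l M N G + x ≤
      G (blockLengths (fun i => BX i ω) M) (blockLengths (fun i => BY i ω) N)} ≤
      Real.exp (-(x ^ 2 / (2 * (M + N) * D ^ 2))) := by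
  obtain ⟨F, hF0, hF1, hF2⟩ := exists_weight_of_hasBoundedDiff hMN hD h₁ h₂ hx
  exact (measureReal_blockLengths_le hl hX hY hXY M N hF0 hF1).trans hF2

end

/-! ### Words and their block lengths -/

lemma sum_blockLengths (B : ℕ → ℕ) (N : ℕ) :
    (blockLengths B N).sum = ∑ j ∈ Finset.range N, B j := by
  induction N with
  | zero => simp [blockLengths]
  | succ N ih => simp [blockLengths_succ, Finset.sum_range_succ, ih]

lemma blockIndex_eq {B : ℕ → ℕ} {N k : ℕ} (h1 : ∑ j ∈ Finset.range N, B j ≤ k)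
    (h2 : k < ∑ j ∈ Finset.range (N + 1), B j) : blockIndex B k = N := by
  refine le_antisymm (Nat.sInf_le h2) (le_csInf ⟨N, h2⟩ fun i hi => ?_)
  by_contra hlt
  have : ∑ j ∈ Finset.range (i + 1), B j ≤ ∑ j ∈ Finset.range N, B j :=
    Finset.sum_le_sum_of_subset (Finset.range_mono (by omega))
  have hi' : k < ∑ j ∈ Finset.range (i + 1), B j := hi
  omega

lemma getElem?_wordOf_blockLengths (c : Bool) (B : ℕ → ℕ) {N k : ℕ}
    (h : k < (blockLengths B N).sum) :
    (wordOf c (blockLengths B N))[k]? = some (blockSeq c B k) := by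
  induction N with
  | zero => simp [blockLengths] at h
  | succ N ih =>
    rw [blockLengths_succ, wordOf_append]
    by_cases hk : k < (blockLengths B N).sum
    · rw [List.getElem?_append_left (by rwa [length_wordOf]), ih hk]
    · rw [List.getElem?_append_right (by rw [length_wordOf]; omega), length_wordOf]
      have hidx : blockIndex B k = N := by
        rw [sum_blockLengths] at hk h
        exact blockIndex_eq (by omega) h
      rw [blockLengths_succ] at h
      simp only [List.sum_append, List.sum_cons, List.sum_nil, add_zero] at h
      simp only [wordOf, List.append_nil, length_blockLengths, blockSeq, hidx]
      rw [List.getElem?_replicate, if_pos (by omega)]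

/-- Both sides are the common prefix of length `min n (blockLengths B N).sum`. The symmetric form
avoids deciding whether `N` blocks fall short of `n` letters or overshoot. -/
lemma take_wordOf_blockLengths (c : Bool) (B : ℕ → ℕ) (N n : ℕ) :
    (wordOf c (blockLengths B N)).take n =
      (List.ofFn (blockWord c B n)).take (blockLengths B N).sum := by
  refine List.ext_getElem? fun k => ?_
  rw [List.getElem?_take, List.getElem?_take, List.getElem?_ofFn]
  by_cases h1 : k < n
  · by_cases h2 : k < (blockLengths B N).sum
    · rw [if_pos h1, if_pos h2, dif_pos h1, getElem?_wordOf_blockLengths c B h2]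
      rfl
    · rw [if_pos h1, if_neg h2, List.getElem?_eq_none_iff, length_wordOf]
      omega
  · rw [if_neg h1, dif_neg h1]
    simp

/-- Together with `lcs_take_le`, this passes between words with a fixed number of blocks and words
with a fixed number of letters. The truncated differences are the overhanging letters, each costing
at most one. -/
lemma lcs_wordOf_le (c c' : Bool) (B B' : ℕ → ℕ) (N N' n : ℕ) :
    lcs (wordOf c (blockLengths B N)) (wordOf c' (blockLengths B' N')) ≤
      lcs (List.ofFn (blockWord c B n)) (List.ofFn (blockWord c' B' n)) +
        ((blockLengths B N).sum - n) + ((blockLengths B' N').sum - n) := by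
  have h1 := lcs_le_take_left (wordOf c (blockLengths B N)) (wordOf c' (blockLengths B' N')) n
  have h2 := lcs_le_take_right ((wordOf c (blockLengths B N)).take n)
    (wordOf c' (blockLengths B' N')) n
  rw [take_wordOf_blockLengths c', take_wordOf_blockLengths c] at h2
  rw [take_wordOf_blockLengths c] at h1
  have h3 := lcs_mono (List.take_sublist (blockLengths B N).sum (List.ofFn (blockWord c B n)))
    (List.take_sublist (blockLengths B' N').sum (List.ofFn (blockWord c' B' n)))
  rw [length_wordOf] at h1 h2
  omega

lemma lcs_take_le (c c' : Bool) (B B' : ℕ → ℕ) (N N' n i : ℕ) :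
    lcs ((List.ofFn (blockWord c B n)).take i) (List.ofFn (blockWord c' B' n)) ≤
      lcs (wordOf c (blockLengths B N)) (wordOf c' (blockLengths B' N')) +
        (i - (blockLengths B N).sum) + (n - (blockLengths B' N').sum) := by
  have h1 := lcs_le_take_left ((List.ofFn (blockWord c B n)).take i)
    (List.ofFn (blockWord c' B' n)) (blockLengths B N).sum
  have h2 := lcs_le_take_right
    (((List.ofFn (blockWord c B n)).take i).take (blockLengths B N).sum)
    (List.ofFn (blockWord c' B' n)) (blockLengths B' N').sum
  rw [List.take_take, min_comm, ← List.take_take, ← take_wordOf_blockLengths c,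
    ← take_wordOf_blockLengths c'] at h2
  rw [List.take_take, min_comm, ← List.take_take, ← take_wordOf_blockLengths c] at h1
  have h3 := lcs_mono ((List.take_sublist i _).trans
    (List.take_sublist n (wordOf c (blockLengths B N))))
    (List.take_sublist n (wordOf c' (blockLengths B' N')))
  simp only [List.length_take, List.length_ofFn] at h1 h2
  omega

lemma wordOf_sublist_ofFn (c : Bool) (B : ℕ → ℕ) (N n : ℕ) (h : (blockLengths B N).sum ≤ n) :
    (wordOf c (blockLengths B N)).Sublist (List.ofFn (blockWord c B n)) := by
  have h1 := take_wordOf_blockLengths c B N n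
  rw [List.take_of_length_le (by rwa [length_wordOf])] at h1
  rw [h1]
  exact List.take_sublist _ _

/-! ### Alignments and common subsequences -/

lemma ofFn_sublist {k : ℕ} {f : Fin k → Bool} {u : List Bool} (e : Fin k → ℕ) (he : StrictMono e)
    (h : ∀ j, u[e j]? = some (f j)) : (List.ofFn f).Sublist u := by
  rw [List.sublist_iff_exists_fin_orderEmbedding_get_eq]
  have hlen : (List.ofFn f).length = k := List.length_ofFn
  have hlt : ∀ j, e j < u.length := fun j => (List.getElem?_eq_some_iff.1 (h j)).1
  refine ⟨OrderEmbedding.ofStrictMono (fun j => ⟨e (Fin.cast hlen j), hlt _⟩) ?_, ?_⟩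
  · intro a b hab
    exact he (show Fin.cast hlen a < Fin.cast hlen b from hab)
  · intro j
    have := (List.getElem?_eq_some_iff.1 (h (Fin.cast hlen j))).2
    rw [List.get_eq_getElem, List.getElem_ofFn]
    exact this.symm

lemma exists_strictMono_of_sublist_ofFn {n : ℕ} {x : Fin n → Bool} {w : List Bool}
    (h : w.Sublist (List.ofFn x)) :
    ∃ f : Fin w.length → Fin n, StrictMono f ∧ ∀ j, w.get j = x (f j) := by
  obtain ⟨f, hf⟩ := List.sublist_iff_exists_fin_orderEmbedding_get_eq.1 h
  refine ⟨fun j => Fin.cast List.length_ofFn (f j), fun a b hab => ?_, fun j => ?_⟩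
  · exact f.strictMono hab
  · rw [hf j, List.get_eq_getElem, List.getElem_ofFn]
    rfl

/-- Listing the pairs by increasing first coordinate spells a common subsequence, and `hi` keeps it
within the first `i` letters of `x`. -/
lemma card_le_lcs_take {m n : ℕ} {x : Fin m → Bool} {y : Fin n → Bool}
    {a : Finset (Fin m × Fin n)} (ha : IsAlignment x y a) {i : ℕ}
    (hi : ∀ p ∈ a, (p.1 : ℕ) < i) :
    a.card ≤ lcs ((List.ofFn x).take i) (List.ofFn y) := by
  have hinj : Set.InjOn Prod.fst (a : Set (Fin m × Fin n)) := by
    intro p hp q hq hpq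
    by_contra hne
    rcases ha.2 p hp q hq hne with h | h
    · exact h.1.ne hpq
    · exact h.1.ne hpq.symm
  have hcard : (a.image Prod.fst).card = a.card := Finset.card_image_of_injOn hinj
  set e := (a.image Prod.fst).orderEmbOfFin hcard with he
  have hmem : ∀ j, ∃ p ∈ a, p.1 = e j := fun j =>
    Finset.mem_image.1 (Finset.orderEmbOfFin_mem _ hcard j)
  choose p hp hpe using hmem
  have h1 : (List.ofFn fun j => x (e j)).Sublist ((List.ofFn x).take i) := by
    refine ofFn_sublist (fun j => (e j : ℕ)) (fun _ _ h => e.strictMono h) fun j => ?_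
    have hlt : (e j : ℕ) < i := hpe j ▸ hi _ (hp j)
    rw [List.getElem?_take, if_pos hlt]
    simp
  have h2 : (List.ofFn fun j => x (e j)).Sublist (List.ofFn y) := by
    refine ofFn_sublist (fun j => ((p j).2 : ℕ)) (fun j j' h => ?_) fun j => ?_
    · have hlt : (p j).1 < (p j').1 := by
        rw [hpe, hpe]
        exact e.strictMono h
      have hne : p j ≠ p j' := fun h => hlt.ne (congrArg Prod.fst h)
      rcases ha.2 _ (hp j) _ (hp j') hne with h | h
      · exact h.2
      · exact absurd h.1 hlt.asymm
    · rw [← hpe j, ha.1 _ (hp j)]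
      simp
  simpa using length_le_lcs h1 h2

lemma exists_isAlignment_card_eq_lcs {m n : ℕ} (x : Fin m → Bool) (y : Fin n → Bool) :
    ∃ b : Finset (Fin m × Fin n), IsAlignment x y b ∧
      b.card = lcs (List.ofFn x) (List.ofFn y) := by
  obtain ⟨w, hx, hy, hw⟩ := exists_length_eq_lcs (List.ofFn x) (List.ofFn y)
  obtain ⟨f, hf, hfx⟩ := exists_strictMono_of_sublist_ofFn hx
  obtain ⟨g, hg, hgy⟩ := exists_strictMono_of_sublist_ofFn hy
  refine ⟨Finset.univ.image fun j => (f j, g j), ⟨?_, ?_⟩, ?_⟩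
  · intro p hp
    obtain ⟨j, -, rfl⟩ := Finset.mem_image.1 hp
    simp only
    rw [← hfx, ← hgy]
  · intro p hp q hq hne
    obtain ⟨j, -, rfl⟩ := Finset.mem_image.1 hp
    obtain ⟨j', -, rfl⟩ := Finset.mem_image.1 hq
    rcases lt_trichotomy j j' with h | rfl | h
    · exact Or.inl ⟨hf h, hg h⟩
    · exact absurd rfl hne
    · exact Or.inr ⟨hf h, hg h⟩
  · rw [Finset.card_image_of_injective, Finset.card_univ, Fintype.card_fin, hw]
    intro j j' h
    exact hf.injective (congrArg Prod.fst h)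

lemma IsAlignment.swap {m n : ℕ} {x : Fin m → Bool} {y : Fin n → Bool}
    {a : Finset (Fin m × Fin n)} (h : IsAlignment x y a) :
    IsAlignment y x (a.image Prod.swap) := by
  refine ⟨fun p hp => ?_, fun p hp q hq hne => ?_⟩
  · obtain ⟨p, hp', rfl⟩ := Finset.mem_image.1 hp
    exact (h.1 p hp').symm
  · obtain ⟨p, hp', rfl⟩ := Finset.mem_image.1 hp
    obtain ⟨q, hq', rfl⟩ := Finset.mem_image.1 hq
    rcases h.2 p hp' q hq' (fun e => hne (congrArg _ e)) with h | h
    · exact Or.inl ⟨h.2, h.1⟩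
    · exact Or.inr ⟨h.2, h.1⟩

lemma IsOptimalAlignment.swap {m n : ℕ} {x : Fin m → Bool} {y : Fin n → Bool}
    {a : Finset (Fin m × Fin n)} (h : IsOptimalAlignment x y a) :
    IsOptimalAlignment y x (a.image Prod.swap) := by
  refine ⟨h.1.swap, fun b hb => ?_⟩
  have := h.2 _ hb.swap
  rwa [Finset.card_image_of_injective _ Prod.swap_injective] at this ⊢

/-! ### Blocks -/

lemma mem_blockAt_self {n : ℕ} (x : Fin n → Bool) (k : Fin n) : k ∈ blockAt x k := by
  refine Finset.mem_filter.2 ⟨Finset.mem_univ _, fun i hi => ?_⟩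
  rw [Finset.uIcc_self, Finset.mem_singleton] at hi
  rw [hi]

/-- Letters of the alternating subsequence sit in distinct blocks: from position `f j` up to any
later `f j'` one meets `f (j + 1)`, which carries the opposite letter. -/
lemma le_card_blocks_of_altWord_sublist {n : ℕ} {x : Fin n → Bool} {c : Bool} {k : ℕ}
    (h : (altWord c k).Sublist (List.ofFn x)) : k ≤ (blocks x).card := by
  obtain ⟨f, hf, hfx⟩ := exists_strictMono_of_sublist_ofFn h
  have hinj : ∀ j j', j < j' → blockAt x (f j) ≠ blockAt x (f j') := by
    intro j j' hjj he
    have hmem : f j' ∈ blockAt x (f j) := he ▸ mem_blockAt_self x (f j')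
    have hlt : (j : ℕ) + 1 < (altWord c k).length := by
      have := j'.2
      have : (j : ℕ) < j' := hjj
      omega
    have h1 : f ⟨j + 1, hlt⟩ ∈ Finset.uIcc (f j') (f j) := by
      rw [Finset.uIcc_of_ge (hf hjj).le, Finset.mem_Icc]
      exact ⟨hf.monotone (Nat.le_succ (j : ℕ)), hf.monotone hjj⟩
    have h2 := (Finset.mem_filter.1 hmem).2 _ h1
    rw [← hfx, ← hfx] at h2
    exact altWord_getElem_succ_ne c k j hlt h2
  have hcard := Finset.card_le_card_of_injOn (s := Finset.univ) (t := blocks x)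
    (fun j => blockAt x (f j)) (fun j _ => Finset.mem_image_of_mem _ (Finset.mem_univ _)) (by
      intro j _ j' _ he
      by_contra hne
      rcases lt_or_gt_of_ne hne with h | h
      · exact hinj _ _ h he
      · exact hinj _ _ h he.symm)
  simpa [length_altWord] using hcard

/-- If an optimal alignment leaves out blocks at the end, then the positions before them have the
same longest common subsequence. -/
lemma exists_lcs_le_of_isOptimalAlignment {m n : ℕ} {x : Fin m → Bool} {y : Fin n → Bool}
    {a : Finset (Fin m × Fin n)} (h : IsOptimalAlignment x y a) :
    ∃ i : ℕ, i + (leftOutAtEnd x (a.image Prod.fst)).card ≤ m ∧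
      lcs (List.ofFn x) (List.ofFn y) ≤ lcs ((List.ofFn x).take i) (List.ofFn y) := by
  set M := a.image Prod.fst with hM
  -- One past the last aligned position, and `0` if nothing is aligned. Every block left out at the
  -- end lies in positions `≥ i`, so there are at most `m - i` of them.
  set i := M.sup fun j => (j : ℕ) + 1 with hi
  have him : i ≤ m := Finset.sup_le fun j _ => j.2
  refine ⟨i, ?_, ?_⟩
  · have hsub : leftOutAtEnd x M ⊆
        (Finset.univ.filter fun k : Fin m => i ≤ (k : ℕ)).image (blockAt x) := by
      intro b hb
      obtain ⟨hb1, hb2⟩ := Finset.mem_filter.1 hb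
      obtain ⟨k, -, rfl⟩ := Finset.mem_image.1 hb1
      refine Finset.mem_image_of_mem _ (Finset.mem_filter.2 ⟨Finset.mem_univ _, ?_⟩)
      refine Finset.sup_le fun j hj => ?_
      by_contra hlt
      exact hb2 k (mem_blockAt_self x k) j (Fin.le_def.2 (by omega)) hj
    have h1 := (Finset.card_le_card hsub).trans Finset.card_image_le
    have h2 : ((Finset.univ.filter fun k : Fin m => i ≤ (k : ℕ)).image Fin.val) ⊆
        Finset.Ico i m := by
      intro k hk
      obtain ⟨k, hk', rfl⟩ := Finset.mem_image.1 hk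
      exact Finset.mem_Ico.2 ⟨(Finset.mem_filter.1 hk').2, k.2⟩
    have h3 := Finset.card_le_card h2
    rw [Finset.card_image_of_injective _ Fin.val_injective, Nat.card_Ico] at h3
    omega
  · obtain ⟨b, hb, hbc⟩ := exists_isAlignment_card_eq_lcs x y
    rw [← hbc]
    refine (h.2 b hb).trans (card_le_lcs_take h.1 fun p hp => ?_)
    exact Finset.le_sup (f := fun j : Fin m => (j : ℕ) + 1) (Finset.mem_image_of_mem _ hp)

/-! ### Few blocks are left out at the end -/

/-- Some optimal alignment leaves out more than the proportion `δ` of the blocks of `x` at the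
end. -/
def ManyLeftOutAtEnd (δ : ℝ) {m n : ℕ} (x : Fin m → Bool) (y : Fin n → Bool) : Prop :=
  ∃ a : Finset (Fin m × Fin n), IsOptimalAlignment x y a ∧
    δ < propLeftOutAtEnd x (a.image Prod.fst)

lemma manyLeftOutAtEnd_of_not_few {δ : ℝ} {m n : ℕ} {x : Fin m → Bool} {y : Fin n → Bool}
    (h : ¬ FewLeftOutAtEnd δ x y) : ManyLeftOutAtEnd δ x y ∨ ManyLeftOutAtEnd δ y x := by
  simp only [FewLeftOutAtEnd, not_forall, not_and_or, not_le] at h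
  obtain ⟨a, ha, h | h⟩ := h
  · exact Or.inl ⟨a, ha, h⟩
  · refine Or.inr ⟨a.image Prod.swap, ha.swap, ?_⟩
    rwa [Finset.image_image, show Prod.fst ∘ Prod.swap = (Prod.snd : Fin m × Fin n → Fin n) from rfl]

lemma natCast_sub_le {a b : ℕ} {r : ℝ} (hr : 0 ≤ r) (h : (a : ℝ) ≤ b + r) :
    ((a - b : ℕ) : ℝ) ≤ r := by
  rcases le_total b a with hab | hab
  · rw [Nat.cast_sub hab]
    linarith
  · rw [Nat.sub_eq_zero_of_le hab]
    simpa using hr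

/-- The first `n / (l + 1)` blocks certainly fit into `n` letters, and their excess bounds the
number of runs from below. Rounding down in the quotient costs a factor of at most `2`. -/
lemma le_card_blocks {l : ℕ} {c : Bool} {B : ℕ → ℕ} (hB : ∀ i, B i ≤ l + 1) {n : ℕ}
    (hn : l + 1 ≤ n)
    (h : ((n / (l + 1) : ℕ) : ℝ) / 6 ≤ blockExcess (blockLengths B (n / (l + 1)))) :
    (n : ℝ) / (12 * (l + 1)) ≤ (blocks (blockWord c B n)).card := by
  set q := n / (l + 1) with hq
  have hsum : (blockLengths B q).sum ≤ n := by
    refine le_trans (List.sum_le_card_nsmul _ (l + 1) ?_) ?_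
    · intro v hv
      obtain ⟨i, -, rfl⟩ := List.mem_map.1 hv
      exact hB i
    · rw [length_blockLengths, smul_eq_mul]
      exact Nat.div_mul_le_self n (l + 1)
  obtain ⟨k, hk, hs⟩ := exists_altWord_sublist_wordOf c (blockLengths B q)
  have h1 := le_card_blocks_of_altWord_sublist (hs.trans (wordOf_sublist_ofFn c B q n hsum))
  have h2 : (blockExcess (blockLengths B q) : ℝ) ≤ k := by exact_mod_cast hk
  have h3 : (k : ℝ) ≤ (blocks (blockWord c B n)).card := by exact_mod_cast h1
  have hq1 : 1 ≤ q := (Nat.one_le_div_iff (Nat.succ_pos l)).2 hn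
  have h4 : n < (q + 1) * (l + 1) := by
    have := Nat.lt_div_mul_add (a := n) (Nat.succ_pos l)
    rw [add_mul, one_mul]
    exact this
  have h5 : n ≤ 2 * q * (l + 1) := h4.le.trans (Nat.mul_le_mul_right _ (by omega))
  have h6 : (n : ℝ) ≤ 2 * q * (l + 1) := by exact_mod_cast h5
  refine le_trans ?_ (h.trans (h2.trans h3))
  rw [div_le_iff₀ (by positivity)]
  linarith

/-- If the block lengths behave as on average, then few blocks are left out at the end. -/
lemma not_manyLeftOutAtEnd {l a n k : ℕ} {δ η u w : ℝ} (hδ : 0 < δ) (hη : 0 < η)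
    (hk : 0 < k) (ha : 12 * (l + 1) ≤ δ * (a + 1)) (hn : l + 1 ≤ n)
    (hkn : 2 * ((a + 1) * k) * l ≤ n) (hnk : n ≤ 2 * ((a + 1) * (k + 1)) * l)
    (hηk : 2 * (a + 1) * l ≤ η * k) {c c' : Bool} {B B' : ℕ → ℕ} (hB : ∀ i, B i ≤ l + 1)
    (hgap : u + 16 * η * k ≤ w)
    (h1 : ((blockLengths B (2 * ((a + 1) * k))).sum : ℝ) ≤ (2 * ((a + 1) * k) : ℕ) * l + η * k)
    (h2 : ((blockLengths B' (2 * ((a + 1) * k))).sum : ℝ) ≤ (2 * ((a + 1) * k) : ℕ) * l + η * k)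
    (h3 : (2 * ((a + 1) * k) : ℕ) * l - η * k ≤ (blockLengths B' (2 * ((a + 1) * k))).sum)
    (h4 : (2 * (a * k) : ℕ) * l - η * k ≤ (blockLengths B (2 * (a * k))).sum)
    (h5 : w - η * k ≤ lcs (wordOf c (blockLengths B (2 * ((a + 1) * k))))
      (wordOf c' (blockLengths B' (2 * ((a + 1) * k)))))
    (h6 : (lcs (wordOf c (blockLengths B (2 * (a * k))))
      (wordOf c' (blockLengths B' (2 * ((a + 1) * k)))) : ℝ) ≤ u + η * k)
    (h7 : ((n / (l + 1) : ℕ) : ℝ) / 6 ≤ blockExcess (blockLengths B (n / (l + 1)))) :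
    ¬ ManyLeftOutAtEnd δ (blockWord c B n) (blockWord c' B' n) := by
  rintro ⟨A, hA, hlt⟩
  obtain ⟨i, hi, hlcs⟩ := exists_lcs_le_of_isOptimalAlignment hA
  have hb := le_card_blocks (c := c) hB hn h7
  set b := (blocks (blockWord c B n)).card
  set r := (leftOutAtEnd (blockWord c B n) (A.image Prod.fst)).card with hr
  have hn0 : (0 : ℝ) < n := by
    have : 0 < n := by omega
    exact_mod_cast this
  have hk0 : (0 : ℝ) < k := by exact_mod_cast hk
  have hηk0 : 0 < η * k := mul_pos hη hk0
  have hb0 : (0 : ℝ) < b := lt_of_lt_of_le (by positivity) hb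
  -- `ha` is made for this: `δ` times the lower bound `n / (12 (l + 1))` for the number of blocks is
  -- at least `n / (a + 1)`.
  have hleft : (n : ℝ) / (a + 1) ≤ r := by
    have h8 : δ * b < r := by
      rw [propLeftOutAtEnd, lt_div_iff₀ hb0] at hlt
      exact hlt
    refine le_trans ?_ h8.le
    refine le_trans ?_ (mul_le_mul_of_nonneg_left hb hδ.le)
    rw [mul_div_assoc', div_le_div_iff₀ (by positivity) (by positivity)]
    have := mul_le_mul_of_nonneg_left ha hn0.le
    linarith
  have hnk' : (n : ℝ) ≤ 2 * ((a + 1) * (k + 1)) * l := by exact_mod_cast hnk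
  have hkn' : 2 * ((a + 1) * k) * l ≤ (n : ℝ) := by exact_mod_cast hkn
  have hi' : (i : ℝ) ≤ 2 * (a * (k + 1)) * l := by
    have h8 : (i : ℝ) + r ≤ n := by exact_mod_cast hi
    have h9 : (i : ℝ) ≤ n - n / (a + 1) := by linarith
    have e : (n : ℝ) - n / (a + 1) = n * (a / (a + 1)) := by
      field_simp
      ring
    rw [e] at h9
    refine h9.trans ?_
    refine (mul_le_mul_of_nonneg_right hnk' (by positivity)).trans (le_of_eq ?_)
    field_simp
  simp only [Nat.cast_mul, Nat.cast_add, Nat.cast_one, Nat.cast_ofNat] at h1 h2 h3 h4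
  have hl0 : (0 : ℝ) ≤ l := Nat.cast_nonneg l
  have ha0 : (0 : ℝ) ≤ a := Nat.cast_nonneg a
  have g1 := lcs_wordOf_le c c' B B' (2 * ((a + 1) * k)) (2 * ((a + 1) * k)) n
  have g2 := lcs_take_le c c' B B' (2 * (a * k)) (2 * ((a + 1) * k)) n i
  have g1' := Nat.cast_le (α := ℝ).2 g1
  have g2' := Nat.cast_le (α := ℝ).2 g2
  have g3' := Nat.cast_le (α := ℝ).2 hlcs
  rw [Nat.cast_add, Nat.cast_add] at g1' g2'
  have e1 := natCast_sub_le (a := (blockLengths B (2 * ((a + 1) * k))).sum) (b := n) hηk0.le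
    (by linarith)
  have e2 := natCast_sub_le (a := (blockLengths B' (2 * ((a + 1) * k))).sum) (b := n) hηk0.le
    (by linarith)
  have e3 := natCast_sub_le (a := i) (b := (blockLengths B (2 * (a * k))).sum)
    (r := 2 * (η * k)) (by linarith) (by linarith)
  have e4 := natCast_sub_le (a := n) (b := (blockLengths B' (2 * ((a + 1) * k))).sum)
    (r := 2 * (η * k)) (by linarith) (by linarith)
  -- The errors add up to `8 η k`: one from each of `h5`, `h6`, `e1`, `e2`, and two from each of
  -- `e3`, `e4`. The gap is `16 η k`.
  linarith

lemma HasBoundedDiff.mono {l N : ℕ} {D D' : ℝ} {F : List ℕ → ℝ} (h : HasBoundedDiff l N D F)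
    (hD : D ≤ D') : HasBoundedDiff l N D' F :=
  fun p q v v' hN hv hv' => (h p q v v' hN hv hv').trans (by linarith)

lemma hasBoundedDiff_const (l N : ℕ) {D : ℝ} (hD : 0 ≤ D) (a : ℝ) :
    HasBoundedDiff l N D fun _ => a :=
  fun _ _ _ _ _ _ _ => le_add_of_nonneg_right hD

section

variable {Ω : Type*} [MeasurableSpace Ω] {P : Measure Ω} [IsProbabilityMeasure P] {l : ℕ}
  {cX cY : Ω → Bool} {BX BY : ℕ → Ω → ℕ}

lemma measureReal_manyLeftOutAtEnd_le (hl : 0 < l) (hX : IsBlockModel P l cX BX)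
    (hY : IsBlockModel P l cY BY)
    (hXY : IndepFun (fun ω => (cX ω, fun i => BX i ω)) (fun ω => (cY ω, fun i => BY i ω)) P)
    {a n k : ℕ} {δ η : ℝ} (hδ : 0 < δ) (hη : 0 < η) (hk : 0 < k) (ha0 : 0 < a)
    (ha : 12 * (l + 1) ≤ δ * (a + 1)) (hn : l + 1 ≤ n)
    (hkn : 2 * ((a + 1) * k) * l ≤ n) (hnk : n ≤ 2 * ((a + 1) * (k + 1)) * l)
    (hηk : 2 * (a + 1) * l ≤ η * k) (c c' : Bool)
    (hgap : meanLcs l c c' (2 * (a * k)) (2 * ((a + 1) * k)) + 16 * η * k ≤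
        meanLcs l c c' (2 * ((a + 1) * k)) (2 * ((a + 1) * k))) :
    P.real {ω | ManyLeftOutAtEnd δ (blockWord c (fun i => BX i ω) n)
      (blockWord c' (fun i => BY i ω) n)} ≤
      6 * Real.exp (-(η ^ 2 / (8 * (a + 1) * (l + 1) ^ 2) * k)) +
        Real.exp (-(((n / (l + 1) : ℕ) : ℝ) / (72 * (l + 1) ^ 2))) := by
  have hk0 : (0 : ℝ) < k := by exact_mod_cast hk
  have hl0 : (0 : ℝ) < l := by exact_mod_cast hl
  have hD : (0 : ℝ) < (l : ℝ) + 1 := by positivity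
  have hηk0 : 0 ≤ η * k := (mul_pos hη hk0).le
  have hN0 : 0 < 2 * ((a + 1) * k) := by positivity
  have hA0 : 0 < 2 * (a * k) := by positivity
  set N := 2 * ((a + 1) * k) with hN
  set A := 2 * (a * k) with hA
  have hNR : (N : ℝ) = 2 * ((a + 1) * k) := by rw [hN]; push_cast; ring
  have hAN : A ≤ N := Nat.mul_le_mul_left 2 (Nat.mul_le_mul_right k (Nat.le_succ a))
  -- One exponent serves the first six deviation events, since at most `2 N = 4 (a + 1) k` block
  -- lengths are involved in each.
  have hexp : ∀ M M' : ℕ, 0 < M + M' → M ≤ N → M' ≤ N →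
      Real.exp (-((η * k) ^ 2 / (2 * (M + M') * ((l : ℝ) + 1) ^ 2))) ≤
        Real.exp (-(η ^ 2 / (8 * (a + 1) * (l + 1) ^ 2) * k)) := by
    intro M M' h0 h1 h2
    have h0' : (0 : ℝ) < M + M' := by exact_mod_cast h0
    have h1' : (M : ℝ) ≤ N := by exact_mod_cast h1
    have h2' : (M' : ℝ) ≤ N := by exact_mod_cast h2
    refine Real.exp_le_exp.2 (neg_le_neg ?_)
    have e : η ^ 2 / (8 * (a + 1) * ((l : ℝ) + 1) ^ 2) * k =
        (η * k) ^ 2 / (8 * (a + 1) * k * ((l : ℝ) + 1) ^ 2) := by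
      field_simp
    rw [e]
    refine div_le_div_of_nonneg_left (by positivity) (by positivity) ?_
    refine mul_le_mul_of_nonneg_right ?_ (by positivity)
    linarith
  set ε := Real.exp (-(η ^ 2 / (8 * (a + 1) * (l + 1) ^ 2) * k))
  set q := n / (l + 1) with hq
  have hq1 : 0 < q := Nat.div_pos hn (Nat.succ_pos l)
  have hq0 : (0 : ℝ) < q := by exact_mod_cast hq1
  have p1 := (measureReal_mean_add_le hl hX hY hXY (M := N) (N := 0) (by omega) hD
    (G := fun s _ => (s.sum : ℝ)) (fun _ => hasBoundedDiff_sum l N)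
    (fun _ => hasBoundedDiff_const l 0 hD.le _) hηk0).trans (hexp N 0 (by omega) le_rfl (by omega))
  have p2 := (measureReal_mean_add_le hl hX hY hXY (M := 0) (N := N) (by omega) hD
    (G := fun _ t => (t.sum : ℝ)) (fun _ => hasBoundedDiff_const l 0 hD.le _)
    (fun _ => hasBoundedDiff_sum l N) hηk0).trans (hexp 0 N (by omega) (by omega) le_rfl)
  have p3 := (measureReal_mean_add_le hl hX hY hXY (M := 0) (N := N) (by omega) hD
    (G := fun _ t => -(t.sum : ℝ)) (fun _ => hasBoundedDiff_const l 0 hD.le _)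
    (fun _ => (hasBoundedDiff_sum l N).neg) hηk0).trans (hexp 0 N (by omega) (by omega) le_rfl)
  have p4 := (measureReal_mean_add_le hl hX hY hXY (M := A) (N := 0) (by omega) hD
    (G := fun s _ => -(s.sum : ℝ)) (fun _ => (hasBoundedDiff_sum l A).neg)
    (fun _ => hasBoundedDiff_const l 0 hD.le _) hηk0).trans (hexp A 0 (by omega) hAN (by omega))
  have p5 := (measureReal_mean_add_le hl hX hY hXY (M := N) (N := N) (by omega) hD
    (G := fun s t => -(lcs (wordOf c s) (wordOf c' t) : ℝ))
    (fun t => (hasBoundedDiff_lcs_left l N c (wordOf c' t)).neg)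
    (fun s => (hasBoundedDiff_lcs_right l N c' (wordOf c s)).neg) hηk0).trans
    (hexp N N (by omega) le_rfl le_rfl)
  have p6 := (measureReal_mean_add_le hl hX hY hXY (M := A) (N := N) (by omega) hD
    (G := fun s t => (lcs (wordOf c s) (wordOf c' t) : ℝ))
    (fun t => hasBoundedDiff_lcs_left l A c (wordOf c' t))
    (fun s => hasBoundedDiff_lcs_right l N c' (wordOf c s)) hηk0).trans
    (hexp A N (by omega) hAN le_rfl)
  have p7 := measureReal_mean_add_le hl hX hY hXY (M := q) (N := 0) (by omega) hD
    (G := fun s _ => -(blockExcess s : ℝ))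
    (fun _ => ((hasBoundedDiff_blockExcess l q).mono (by
      have : (1 : ℝ) ≤ l := by exact_mod_cast hl
      linarith)).neg)
    (fun _ => hasBoundedDiff_const l 0 hD.le _) (x := q / 6) (by positivity)
  have e7 : (q / 6 : ℝ) ^ 2 / (2 * (q + (0 : ℕ)) * ((l : ℝ) + 1) ^ 2) =
      q / (72 * ((l : ℝ) + 1) ^ 2) := by
    push_cast
    field_simp
    ring
  rw [e7] at p7
  set S1 := {ω | _ ≤ ((blockLengths (fun i => BX i ω) N).sum : ℝ)}
  set S2 := {ω | _ ≤ ((blockLengths (fun i => BY i ω) N).sum : ℝ)}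
  set S3 := {ω | _ ≤ -((blockLengths (fun i => BY i ω) N).sum : ℝ)}
  set S4 := {ω | _ ≤ -((blockLengths (fun i => BX i ω) A).sum : ℝ)}
  set S5 := {ω | _ ≤ -(lcs (wordOf c (blockLengths (fun i => BX i ω) N))
    (wordOf c' (blockLengths (fun i => BY i ω) N)) : ℝ)}
  set S6 := {ω | _ ≤ (lcs (wordOf c (blockLengths (fun i => BX i ω) A))
    (wordOf c' (blockLengths (fun i => BY i ω) N)) : ℝ)}
  set S7 := {ω | _ ≤ -(blockExcess (blockLengths (fun i => BX i ω) q) : ℝ)}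
  have hsub : ∀ᵐ ω ∂P, ManyLeftOutAtEnd δ (blockWord c (fun i => BX i ω) n)
      (blockWord c' (fun i => BY i ω) n) → ω ∈ S1 ∪ (S2 ∪ (S3 ∪ (S4 ∪ (S5 ∪ (S6 ∪ S7))))) := by
    filter_upwards [hX.ae_mem hl] with ω hω hmany
    by_contra hgood
    simp only [Set.mem_union, not_or] at hgood
    obtain ⟨g1, g2, g3, g4, g5, g6, g7⟩ := hgood
    simp only [S1, S2, S3, S4, S5, S6, S7, Set.mem_ofPred_eq, not_le, meanOver₂, meanOver_const,
      meanOver_neg, meanOver_sum hl] at g1 g2 g3 g4 g5 g6 g7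
    have hB : ∀ i, BX i ω ≤ l + 1 := by
      intro i
      rcases hω i with h | h | h <;> rw [h] <;> omega
    refine not_manyLeftOutAtEnd hδ hη hk ha hn hkn hnk hηk hB hgap g1.le g2.le (by linarith)
      (by linarith) ?_ g6.le ?_ hmany
    · have e : meanLcs l c c' N N = meanOver l N fun s => meanOver l N fun t =>
        (lcs (wordOf c s) (wordOf c' t) : ℝ) := rfl
      rw [e]
      linarith
    · linarith [le_meanOver_blockExcess hl q]
  have hle : P.real {ω | ManyLeftOutAtEnd δ (blockWord c (fun i => BX i ω) n)
      (blockWord c' (fun i => BY i ω) n)} ≤ P.real (S1 ∪ (S2 ∪ (S3 ∪ (S4 ∪ (S5 ∪ (S6 ∪ S7)))))) :=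
    ENNReal.toReal_mono (measure_ne_top _ _) (measure_mono_ae hsub)
  have u1 := measureReal_union_le (μ := P) S1 (S2 ∪ (S3 ∪ (S4 ∪ (S5 ∪ (S6 ∪ S7)))))
  have u2 := measureReal_union_le (μ := P) S2 (S3 ∪ (S4 ∪ (S5 ∪ (S6 ∪ S7))))
  have u3 := measureReal_union_le (μ := P) S3 (S4 ∪ (S5 ∪ (S6 ∪ S7)))
  have u4 := measureReal_union_le (μ := P) S4 (S5 ∪ (S6 ∪ S7))
  have u5 := measureReal_union_le (μ := P) S5 (S6 ∪ S7)
  have u6 := measureReal_union_le (μ := P) S6 S7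
  linarith

end

/-- One optimal alignment leaving out many blocks of the first word is exponentially unlikely. -/
theorem exists_measureReal_manyLeftOutAtEnd_le {l : ℕ} (hl : 0 < l) {δ : ℝ} (hδ : 0 < δ) :
    ∃ θ : ℝ, 0 < θ ∧ ∃ n₀ : ℕ,
      ∀ (Ω : Type*) [MeasurableSpace Ω] (P : Measure Ω) [IsProbabilityMeasure P]
        (cX cY : Ω → Bool) (BX BY : ℕ → Ω → ℕ),
        IsBlockModel P l cX BX → IsBlockModel P l cY BY →
        IndepFun (fun ω => (cX ω, fun i => BX i ω)) (fun ω => (cY ω, fun i => BY i ω)) P →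
        ∀ n : ℕ, n₀ ≤ n →
          P.real {ω | ManyLeftOutAtEnd δ (blockWord (cX ω) (fun i => BX i ω) n)
              (blockWord (cY ω) (fun i => BY i ω) n)} ≤ 28 * Real.exp (-θ * (n : ℝ)) := by
  obtain ⟨a, ha⟩ := exists_nat_ge (12 * ((l : ℝ) + 1) / δ)
  obtain ⟨ha0, ha⟩ : 0 < a + 1 ∧ 12 * ((l : ℝ) + 1) ≤ δ * ((a + 1 : ℕ) + 1) := by
    refine ⟨Nat.succ_pos a, ?_⟩
    rw [div_le_iff₀ hδ] at ha
    push_cast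
    nlinarith
  -- Passing to the successor makes `a` positive, so the shorter word has at least one block and the
  -- deviation bounds apply to it.
  generalize a + 1 = a at ha0 ha
  obtain ⟨γ, hγ, hgap⟩ := eventually_meanLcs_add_le hl a
  have hgap' : ∀ᶠ k : ℕ in Filter.atTop, ∀ c c' : Bool,
      meanLcs l c c' (2 * (a * k)) (2 * ((a + 1) * k)) + γ * k ≤
        meanLcs l c c' (2 * ((a + 1) * k)) (2 * ((a + 1) * k)) :=
    Filter.eventually_all.2 fun c => Filter.eventually_all.2 fun c' => hgap c c'
  obtain ⟨η, hη, rfl⟩ : ∃ η : ℝ, 0 < η ∧ γ = 16 * η := ⟨γ / 16, by positivity, by ring⟩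
  have hlarge : ∀ᶠ k : ℕ in Filter.atTop, 2 * (a + 1) * l ≤ η * k :=
    (tendsto_natCast_atTop_atTop.const_mul_atTop hη).eventually_ge_atTop _
  obtain ⟨k₀, hk₀⟩ := Filter.eventually_atTop.1
    ((hgap'.and hlarge).and (Filter.eventually_gt_atTop 0))
  have hl0 : (0 : ℝ) < l := by exact_mod_cast hl
  set d := 2 * (a + 1) * l with hd
  have hd0 : 0 < d := by positivity
  have hd0' : (0 : ℝ) < d := by exact_mod_cast hd0
  set κ := η ^ 2 / (8 * (a + 1) * ((l : ℝ) + 1) ^ 2) with hκ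
  have hκ0 : 0 < κ := by positivity
  -- The two terms match the two exponents of `measureReal_manyLeftOutAtEnd_le`; the additional
  -- factor `2` in each denominator absorbs the rounding in `n / d` and `n / (l + 1)`, see `hhalf`.
  set θ := min (κ / (2 * d)) (1 / (144 * ((l : ℝ) + 1) ^ 3)) with hθ
  refine ⟨θ, by positivity, d * (k₀ + 1) + (l + 1), ?_⟩
  intro Ω _ P _ cX cY BX BY hX hY hXY n hn
  have hhalf : ∀ m : ℕ, 0 < m → m ≤ n → (n : ℝ) / (2 * m) ≤ (n / m : ℕ) := by
    intro m hm hmn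
    have h1 : n < n / m * m + m := Nat.lt_div_mul_add hm
    have h2 : 1 * m ≤ n / m * m := Nat.mul_le_mul_right m ((Nat.one_le_div_iff hm).2 hmn)
    have h3 : n ≤ n / m * (2 * m) := by
      rw [mul_left_comm]
      omega
    rw [div_le_iff₀ (by positivity)]
    exact_mod_cast h3
  set k := n / d with hk
  have hkk₀ : k₀ ≤ k := (Nat.le_div_iff_mul_le hd0).2 (by nlinarith)
  obtain ⟨⟨hgapk, hlargek⟩, hkpos⟩ := hk₀ k hkk₀
  have hkn : 2 * ((a + 1) * k) * l ≤ n := by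
    have h := Nat.div_mul_le_self n d
    rw [← hk] at h
    calc 2 * ((a + 1) * k) * l = k * d := by rw [hd]; ring
      _ ≤ n := h
  have hnk : n ≤ 2 * ((a + 1) * (k + 1)) * l := by
    have h := (Nat.lt_div_mul_add (a := n) hd0).le
    rw [← hk] at h
    calc n ≤ k * d + d := h
      _ = 2 * ((a + 1) * (k + 1)) * l := by rw [hd]; ring
  have hbound : ∀ c c' : Bool, P.real {ω | ManyLeftOutAtEnd δ (blockWord c (fun i => BX i ω) n)
      (blockWord c' (fun i => BY i ω) n)} ≤ 7 * Real.exp (-θ * n) := by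
    intro c c'
    refine (measureReal_manyLeftOutAtEnd_le hl hX hY hXY hδ hη hkpos ha0 ha (by omega) hkn hnk
      hlargek c c' (hgapk c c')).trans ?_
    have h1 : Real.exp (-(κ * k)) ≤ Real.exp (-θ * n) := by
      refine Real.exp_le_exp.2 ?_
      rw [neg_mul, neg_le_neg_iff]
      calc θ * n ≤ κ / (2 * d) * n := mul_le_mul_of_nonneg_right (min_le_left _ _) (by positivity)
        _ = κ * (n / (2 * d)) := by ring
        _ ≤ κ * k := mul_le_mul_of_nonneg_left (hhalf d hd0 (by nlinarith)) hκ0.le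
    have h2 : Real.exp (-(((n / (l + 1) : ℕ) : ℝ) / (72 * (l + 1) ^ 2))) ≤
        Real.exp (-θ * n) := by
      refine Real.exp_le_exp.2 ?_
      rw [neg_mul, neg_le_neg_iff]
      have h3 := hhalf (l + 1) (Nat.succ_pos l) (by omega)
      push_cast at h3
      calc θ * n ≤ 1 / (144 * ((l : ℝ) + 1) ^ 3) * n :=
            mul_le_mul_of_nonneg_right (min_le_right _ _) (by positivity)
        _ = (n / (2 * ((l : ℝ) + 1))) / (72 * (l + 1) ^ 2) := by
            field_simp
            ring
        _ ≤ _ := div_le_div_of_nonneg_right h3 (by positivity)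
    linarith
  -- The bound holds for all fixed first letters, so a union bound over the four pairs suffices and
  -- gives `4 * 7 = 28`.
  set T := fun c c' : Bool => {ω | ManyLeftOutAtEnd δ (blockWord c (fun i => BX i ω) n)
      (blockWord c' (fun i => BY i ω) n)} with hT
  have hsub : {ω | ManyLeftOutAtEnd δ (blockWord (cX ω) (fun i => BX i ω) n)
      (blockWord (cY ω) (fun i => BY i ω) n)} ⊆
      (T false false ∪ T false true) ∪ (T true false ∪ T true true) := by
    intro ω hω
    have h : ω ∈ T (cX ω) (cY ω) := hω
    cases hx : cX ω <;> cases hy : cY ω <;> rw [hx, hy] at h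
    · exact Or.inl (Or.inl h)
    · exact Or.inl (Or.inr h)
    · exact Or.inr (Or.inl h)
    · exact Or.inr (Or.inr h)
  have h0 := measureReal_mono (μ := P) hsub
  have u1 := measureReal_union_le (μ := P) (T false false ∪ T false true)
    (T true false ∪ T true true)
  have u2 := measureReal_union_le (μ := P) (T false false) (T false true)
  have u3 := measureReal_union_le (μ := P) (T true false) (T true true)
  linarith [hbound false false, hbound false true, hbound true false, hbound true true]

end BlockLCS

theorem mainTheorem3 (l : ℕ) (hl : 0 < l) (δ : ℝ) (hδ : 0 < δ) :
    ∃ θ : ℝ, 0 < θ ∧ ∃ n₀ : ℕ,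
      ∀ (Ω : Type*) [MeasurableSpace Ω] (P : Measure Ω) [IsProbabilityMeasure P]
        (cX cY : Ω → Bool) (BX BY : ℕ → Ω → ℕ),
        BlockLCS.IsBlockModel P l cX BX → BlockLCS.IsBlockModel P l cY BY →
        IndepFun (fun ω => (cX ω, fun i => BX i ω)) (fun ω => (cY ω, fun i => BY i ω)) P →
        ∀ n : ℕ, n₀ ≤ n →
          P.real {ω | ¬ BlockLCS.FewLeftOutAtEnd δ
              (BlockLCS.blockWord (cX ω) (fun i => BX i ω) n)
              (BlockLCS.blockWord (cY ω) (fun i => BY i ω) n)} ≤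
            2 * Real.exp (-θ * (n : ℝ)) := by
  obtain ⟨θ, hθ, n₀, h⟩ := BlockLCS.exists_measureReal_manyLeftOutAtEnd_le hl hδ
  have hlim : Filter.Tendsto (fun n : ℕ => Real.exp (-(θ / 2 * (n : ℝ)))) Filter.atTop (nhds 0) :=
    Real.tendsto_exp_neg_atTop_nhds_zero.comp
      (tendsto_natCast_atTop_atTop.const_mul_atTop (half_pos hθ))
  obtain ⟨n₁, hn₁⟩ := Filter.eventually_atTop.1
    (hlim.eventually_lt_const (show (0 : ℝ) < 1 / 28 by norm_num))
  -- Half of the exponent is spent on the constant: exchanging the roles of the words gives a total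
  -- of `2 * 28 * exp (-θ n)`, and `exp (-θ n / 2) < 1 / 28` for `n ≥ n₁`.
  refine ⟨θ / 2, half_pos hθ, max n₀ n₁, ?_⟩
  intro Ω _ P _ cX cY BX BY hX hY hXY n hn
  have h1 := h Ω P cX cY BX BY hX hY hXY n ((le_max_left _ _).trans hn)
  have h2 := h Ω P cY cX BY BX hY hX hXY.symm n ((le_max_left _ _).trans hn)
  have h3 := hn₁ n ((le_max_right _ _).trans hn)
  have hsub : {ω | ¬ BlockLCS.FewLeftOutAtEnd δ
      (BlockLCS.blockWord (cX ω) (fun i => BX i ω) n)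
      (BlockLCS.blockWord (cY ω) (fun i => BY i ω) n)} ⊆
      {ω | BlockLCS.ManyLeftOutAtEnd δ (BlockLCS.blockWord (cX ω) (fun i => BX i ω) n)
        (BlockLCS.blockWord (cY ω) (fun i => BY i ω) n)} ∪
      {ω | BlockLCS.ManyLeftOutAtEnd δ (BlockLCS.blockWord (cY ω) (fun i => BY i ω) n)
        (BlockLCS.blockWord (cX ω) (fun i => BX i ω) n)} :=
    fun ω hω => BlockLCS.manyLeftOutAtEnd_of_not_few hω
  refine (measureReal_mono hsub).trans ((measureReal_union_le _ _).trans ?_)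
  have e : Real.exp (-θ * (n : ℝ)) =
      Real.exp (-(θ / 2 * (n : ℝ))) * Real.exp (-(θ / 2 * (n : ℝ))) := by
    rw [← Real.exp_add]
    congr 1
    ring
  rw [e] at h1 h2
  rw [neg_mul]
  nlinarith [Real.exp_pos (-(θ / 2 * (n : ℝ)))]
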